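/- **Setting.** Consider a two-player zero-sum stochastic game on a finite state space $S\cup\{0\}$ with finite nonempty action sets $A_1(i), A_2(i)$, transition probabilities $P_{ij}(u,v)$ and real costs $c(i,u,v)$; player 1 minimizes and player 2 maximizes the cumulative cost. The game is alternating: $S=S_1\sqcup S_2$, $|A_2(i)|=1$ for $i\in S_1$, $|A_1(i)|=1$ for $i\in S_2$, and $P_{ij}(u,v)=0$ whenever $i,j$ are both in $S_1$ or both in $S_2$. Write $a=(u,v)$ for a combined action at $i$, and call a map $\pi$ that assigns a combined action to every state a (combined stationary) policy; $X^\pi$ is the Markov chain it induces. For stationary policies $\mu,\nu$ of the two players let $J^{\mu,\nu}(i)=\mathbb E\big[\sum_{k\ge 0}c(X_k,\mu(X_k),\nu(X_k))\,\big|\,X_0=i\big]$. Let $p$ be a distribution of initial states, and assume: 1. for every policy $\pi$ and every state $i$, the chain $X^\pi$ with $X_0\sim p$ reaches $i$ with positive probability; 2. for all states $i,j$ and combined actions $a,b$ at $i$, $P_{ij}(a)>0$ if and only if $P_{ij}(b)>0$; 3. state $0$ is absorbing and has cost $0$ under every action, and the directed graph on $S$ with an edge $i\to j$ whenever $P_{ij}(a)>0$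 for some $a$ is acyclic (no self-loops either), so $0$ is the only absorbing state. Put $c'(i,a)=c(i,a)$ for $i\notin S_2$ and $c'(i,a)=-c(i,a)$ for $i\in S_2$, and let $(T'J)(i)=\min_a\big[c'(i,a)-\sum_j P_{ij}(a)J(j)\big]$ be the negamin Bellman operator. **Algorithm.** Let $\beta:\mathbb N\to[0,\infty)$ with $\sum_t\beta(t)=\infty$ and $\sum_t\beta(t)^2<\infty$. Start from a deterministic vector $J_0$ (for instance $J_0=0$). At iteration $t$, let $\pi_t$ be a greedy policy, i.e. $\pi_t(i)$ minimizes $c'(i,a)-\sum_jP_{ij}(a)J_t(j)$ over $a$ for every $i$, ties being broken in any non-anticipating way; given the past, simulate a trajectory $X^{(t)}$ of the Markov chain $X^{\pi_t}$ with initial distribution $p$. For every state $i$ visited by $X^{(t)}$, with first visit time $N_t(i)$, set $$J_{t+1}(i)=(1-\gamma_t(i))J_t(i)+\gamma_t(i)\sum_{k\ge N_t(i)}(-1)^{k-N_t(i)}c'\big(X^{(t)}_k,\pi_t(X^{(t)}_k)\big),$$ and set $J_{t+1}(i)=J_t(i)$ for every other state. The step size is either $\gamma_t(i)=\beta(t)$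 for all $t,i$, or $\gamma_t(i)=\beta(n_t(i))$ for all $t,i$, where $n_t(i)$ is the number of iterations $\tau<t$ whose trajectory visits $i$. **Theorem (Alternating Zero-Sum Game).** The game has a value $J^*$, that is, $\inf_\mu\sup_\nu J^{\mu,\nu}(i)=\sup_\nu\inf_\mu J^{\mu,\nu}(i)=J^*(i)$ for every state $i$, and it satisfies the minimax Bellman equation $J^*(i)=\min_u\max_v\big[c(i,u,v)+\sum_jP_{ij}(u,v)J^*(j)\big]$. The function $J'(i)=J^*(i)$ for $i\notin S_2$, $J'(i)=-J^*(i)$ for $i\in S_2$, is the unique solution of $T'J'=J'$. With either step-size rule, almost surely $J_t(i)\to J'(i)$ for every state $i$; and $J^*$ is recovered from $J'$ by the same change of sign on $S_2$, so that, after this change of sign, $J_t$ converges almost surely to $J^*$. -/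

import Mathlib

open MeasureTheory ProbabilityTheory Filter Topology

universe u v z

noncomputable section

/-- A two-player zero-sum stochastic game on the state set `S`, with a distinguished state `zero`
and, in every state, finite nonempty action sets for the two players. Player 1 minimizes and
player 2 maximizes the cumulative cost. -/
structure StochasticGame (S : Type u) where
  A₁ : S → Type v
  A₂ : S → Type v
  finite₁ : ∀ i, Finite (A₁ i)
  finite₂ : ∀ i, Finite (A₂ i)
  nonempty₁ : ∀ i, Nonempty (A₁ i)
  nonempty₂ : ∀ i, Nonempty (A₂ i)
  /-- `P i u v j` is the probability of moving from `i` to `j` under the action pair `(u, v)`. -/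
  P : ∀ i, A₁ i → A₂ i → PMF S
  c : ∀ i, A₁ i → A₂ i → ℝ
  zero : S

attribute [instance] StochasticGame.finite₁ StochasticGame.finite₂
  StochasticGame.nonempty₁ StochasticGame.nonempty₂

/-- An alternating game: the states other than `zero` are partitioned into the set `S₁` where
player 1 moves and the set `S₂` where player 2 moves; the other player has a single action there,
and no player moves twice in a row. -/
structure AlternatingGame (S : Type u) extends StochasticGame.{u, v} S where
  S₁ : Set S
  S₂ : Set S
  disjoint : Disjoint S₁ S₂
  cover : S₁ ∪ S₂ = {zero}ᶜ
  trivial₂ : ∀ i ∈ S₁, Subsingleton (A₂ i)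
  trivial₁ : ∀ i ∈ S₂, Subsingleton (A₁ i)
  alternate : ∀ i j u v, (i ∈ S₁ ∧ j ∈ S₁) ∨ (i ∈ S₂ ∧ j ∈ S₂) → P i u v j = 0

namespace StochasticGame

variable {S : Type u}

/-- Stationary policies that choose the combined action `(u, v)` in every state. -/
abbrev JointPolicy (G : StochasticGame.{u, v} S) := ∀ i, G.A₁ i × G.A₂ i

/-- The combined policy of a policy `μ` of player 1 and a policy `ν` of player 2. -/
def joint (G : StochasticGame.{u, v} S) (μ : ∀ i, G.A₁ i) (ν : ∀ i, G.A₂ i) :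
    G.JointPolicy := fun i => (μ i, ν i)

section Chain

variable [Finite S] [MeasurableSpace S] [DiscreteMeasurableSpace S]

/-- The transition kernel of the Markov chain `X^π`. -/
def stepKernel (G : StochasticGame.{u, v} S) (π : G.JointPolicy) : Kernel S S :=
  Kernel.ofFunOfCountable fun i => (G.P i (π i).1 (π i).2).toMeasure

instance (G : StochasticGame.{u, v} S) (π : G.JointPolicy) :
    IsMarkovKernel (G.stepKernel π) :=
  ⟨fun i => PMF.toMeasure.isProbabilityMeasure (G.P i (π i).1 (π i).2)⟩

/-- The same transition kernel, as a function of the history up to time `n`: only the last state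
matters. -/
def histKernel (G : StochasticGame.{u, v} S) (π : G.JointPolicy) (n : ℕ) :
    Kernel (∀ _ : Finset.Iic n, S) S :=
  (G.stepKernel π).comap (fun h => h ⟨n, Finset.mem_Iic.2 le_rfl⟩) (measurable_pi_apply _)

instance (G : StochasticGame.{u, v} S) (π : G.JointPolicy) (n : ℕ) :
    IsMarkovKernel (G.histKernel π n) :=
  inferInstanceAs (IsMarkovKernel ((G.stepKernel π).comap _ _))

/-- The law, on the space of trajectories, of the Markov chain `X^π` with initial
distribution `p`. -/
def chainLaw (G : StochasticGame.{u, v} S) (p : PMF S) (π : G.JointPolicy) :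
    Measure (ℕ → S) :=
  Kernel.trajMeasure (X := fun _ => S) p.toMeasure (G.histKernel π)

/-- `q_π(i)`: the probability that the chain with initial distribution `p` ever reaches `i`. -/
def reachProb (G : StochasticGame.{u, v} S) (p : PMF S) (π : G.JointPolicy) (i : S) : ℝ :=
  (G.chainLaw p π).real {x | ∃ k, x k = i}

/-- `J^{μ,ν}(i)`: the expected cumulative cost of the game started in `i`. -/
def cost (G : StochasticGame.{u, v} S) (μ : ∀ i, G.A₁ i) (ν : ∀ i, G.A₂ i) (i : S) : ℝ :=
  ∫ x, ∑' k, G.c (x k) (μ (x k)) (ν (x k)) ∂(G.chainLaw (PMF.pure i) (G.joint μ ν))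

/-- `J` is the value function of the game: `inf_μ sup_ν J^{μ,ν} = sup_ν inf_μ J^{μ,ν} = J`. -/
def IsValue (G : StochasticGame.{u, v} S) (J : S → ℝ) : Prop :=
  ∀ i, (⨅ μ : ∀ i, G.A₁ i, ⨆ ν : ∀ i, G.A₂ i, G.cost μ ν i) = J i ∧
    (⨆ ν : ∀ i, G.A₂ i, ⨅ μ : ∀ i, G.A₁ i, G.cost μ ν i) = J i

/-- Every state is reached with positive probability under every policy. -/
def Reachable (G : StochasticGame.{u, v} S) (p : PMF S) : Prop :=
  ∀ (π : G.JointPolicy) (i : S), 0 < G.reachProb p π i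

end Chain

/-- The possible one-step transitions do not depend on the actions. -/
def CommonTransitions (G : StochasticGame.{u, v} S) : Prop :=
  ∀ (i j : S) (a b : G.A₁ i × G.A₂ i), 0 < G.P i a.1 a.2 j ↔ 0 < G.P i b.1 b.2 j

/-- The edges of the reachability graph between states other than `zero`. -/
def Edge (G : StochasticGame.{u, v} S) (i j : S) : Prop :=
  i ≠ G.zero ∧ j ≠ G.zero ∧ ∃ a : G.A₁ i × G.A₂ i, 0 < G.P i a.1 a.2 j

/-- The structural assumption of shortest path problems: `zero` is absorbing and free of cost, and
the reachability graph on the other states has no directed cycle. Self-loops are cycles, so `zero`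
is the only absorbing state. -/
structure IsShortestPath (G : StochasticGame.{u, v} S) : Prop where
  absorbing : ∀ a b, G.P G.zero a b G.zero = 1
  cost_zero : ∀ a b, G.c G.zero a b = 0
  acyclic : ∀ i, ¬ Relation.TransGen G.Edge i i

/-- The minimax Bellman operator `T`. -/
def minimaxOp [Fintype S] (G : StochasticGame.{u, v} S) (J : S → ℝ) (i : S) : ℝ :=
  ⨅ u : G.A₁ i, ⨆ v : G.A₂ i, (G.c i u v + ∑ j, (G.P i u v j).toReal * J j)

end StochasticGame

/-- The two choices of the step size: `β(t)` and `β(n_t(i))`. -/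
inductive StepRule
  | time
  | visits

open Classical in
/-- The step size `γ_t(i)`, where `x τ` is the trajectory of iteration `τ` and `n_t(i)` is the
number of iterations before `t` whose trajectory visits `i`. -/
def stepSize {S : Type u} (β : ℕ → ℝ) (x : ℕ → ℕ → S) (t : ℕ) (i : S) : StepRule → ℝ
  | StepRule.time => β t
  | StepRule.visits => β ((Finset.range t).filter fun τ => ∃ k, x τ k = i).card

namespace AlternatingGame

variable {S : Type u}

open Classical in
/-- Change of sign at the states of player 2. It maps `J*` to `J'` and `J'` to `J*`. -/
def flip (G : AlternatingGame.{u, v} S) (J : S → ℝ) (i : S) : ℝ :=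
  if i ∈ G.S₂ then -J i else J i

open Classical in
/-- The negamin cost `c'`: the cost from the perspective of the player who moves. -/
def negCost (G : AlternatingGame.{u, v} S) (i : S) (a : G.A₁ i × G.A₂ i) : ℝ :=
  if i ∈ G.S₂ then -G.c i a.1 a.2 else G.c i a.1 a.2

/-- `c'(i,a) - ∑_j P_ij(a) J(j)`. -/
def negQ [Fintype S] (G : AlternatingGame.{u, v} S) (J : S → ℝ) (i : S)
    (a : G.A₁ i × G.A₂ i) : ℝ :=
  G.negCost i a - ∑ j, (G.P i a.1 a.2 j).toReal * J j

/-- The negamin Bellman operator `T'`. -/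
def negaminOp [Fintype S] (G : AlternatingGame.{u, v} S) (J : S → ℝ) (i : S) : ℝ :=
  ⨅ a : G.A₁ i × G.A₂ i, G.negQ J i a

/-- `π` is a greedy policy for `J`: it minimizes `T'_π J` in every component. -/
def IsGreedy [Fintype S] (G : AlternatingGame.{u, v} S) (J : S → ℝ)
    (π : G.JointPolicy) : Prop :=
  ∀ i a, G.negQ J i (π i) ≤ G.negQ J i a

/-- The Monte Carlo estimate from the trajectory `x` under `π`, for a state `i` that it visits: the
tail cost from the first visit `N` of `i`, with costs `c'` and discount factor `-1`. -/
def estimate (G : AlternatingGame.{u, v} S) (x : ℕ → S) (π : G.JointPolicy) (i : S) : ℝ :=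
  ∑' k, (-1 : ℝ) ^ k *
    G.negCost (x (sInf {n | x n = i} + k)) (π (x (sInf {n | x n = i} + k)))

open Classical in
/-- The iterates `J_t` of the algorithm started in `J₀`, when iteration `t` uses the policy `π t`
and produces the trajectory `x t`. -/
def iterate (G : AlternatingGame.{u, v} S) (β : ℕ → ℝ) (rule : StepRule) (J₀ : S → ℝ)
    (x : ℕ → ℕ → S) (π : ℕ → G.JointPolicy) : ℕ → S → ℝ
  | 0 => J₀
  | t + 1 => fun i =>
      if ∃ k, x t k = i then
        (1 - stepSize β x t i rule) * iterate G β rule J₀ x π t i +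
          stepSize β x t i rule * G.estimate (x t) (π t) i
      else iterate G β rule J₀ x π t i

/-- A run of the algorithm on a probability space. `ℱ t` is the information available before the
trajectory `X t` of iteration `t` is simulated. The policy `pol t` is greedy for the current
iterate (ties may be broken in any non-anticipating way), and, given the past, `X t` is a Markov
chain that follows `pol t` from an initial state with distribution `p`. -/
structure IsRun [Fintype S] [MeasurableSpace S] [DiscreteMeasurableSpace S]
    (G : AlternatingGame.{u, v} S) (p : PMF S) (β : ℕ → ℝ) (rule : StepRule) (J₀ : S → ℝ)
    {Ω : Type z} {mΩ : MeasurableSpace Ω} (Pr : Measure Ω) (ℱ : Filtration ℕ mΩ)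
    (X : ℕ → Ω → ℕ → S) (pol : ℕ → Ω → G.JointPolicy) : Prop where
  measurable_X : ∀ t, Measurable[ℱ (t + 1)] (X t)
  measurable_pol : ∀ t π, MeasurableSet[ℱ t] {ω | pol t ω = π}
  greedy : ∀ t ω,
    G.IsGreedy (G.iterate β rule J₀ (fun s => X s ω) (fun s => pol s ω) t) (pol t ω)
  law : ∀ t (B : Set (ℕ → S)), MeasurableSet B →
    Pr⟦X t ⁻¹' B | ℱ t⟧ =ᵐ[Pr] fun ω => (G.chainLaw p (pol t ω)).real B

end AlternatingGame

end

/-! Acyclicity turns everything into backward induction. Off `zero`, the evaluation and negamin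
equations at a state involve only its successors and `zero`, so finitely many iterations solve them
(`exists_fixedPoint`). Since the players alternate, the sign change on `S₂` turns the negamin
equation into a one-step saddle-point condition (`negQ_flip`, `lookahead_saddlePoint`). The
comparison lemmas `policyValue_le` and `le_policyValue` promote it to a saddle point in stationary
policies, which gives the value and the minimax equation.

For the algorithm, `estimate_eq` splits the Monte Carlo estimate at `i` into the negamin cost of the
current policy and a sum of one-step prediction errors. Multiplied by the step sizes, these errors
are martingale differences whose squares have a pathwise bounded sum, so their series converges
almost surely. Reachability makes the steps actually taken at `i` sum to infinity. Each coordinate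
is thus a scalar stochastic approximation with a moving target, the cost of the policy `π_t`.

The target is controlled by induction on depth (`tendsto_iterate`). If the targets at the successors
of `i` eventually equal `J'`, the iterates there converge to `J'`; as the action set is finite, the
greedy action at `i` is then eventually optimal for `J'`, so the target at `i` eventually equals
`J'(i)` exactly. -/

noncomputable section

/-! ### The scalar stochastic approximation recursion -/

/-- Since `1 - a ≤ exp (-a)`, the accumulated factor is at most the exponential of minus a divergent
sum. -/
theorem tendsto_zero_of_le_one_sub_mul {v a : ℕ → ℝ} (hv : ∀ t, 0 ≤ v t)
    (ha : Tendsto (fun n => ∑ s ∈ Finset.range n, a s) atTop atTop)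
    {T : ℕ} (h : ∀ t ≥ T, v (t + 1) ≤ (1 - a t) * v t) : Tendsto v atTop (𝓝 0) := by
  set A : ℕ → ℝ := fun n => ∑ s ∈ Finset.range n, a s with hA
  have key : ∀ t ≥ T, v t ≤ Real.exp (A T - A t) * v T := by
    intro t ht
    induction t, ht using Nat.le_induction with
    | base => simp
    | succ t ht ih =>
      have h1 : A T - A (t + 1) = -a t + (A T - A t) := by
        simp only [hA, Finset.sum_range_succ]; ring
      rw [h1, Real.exp_add, mul_assoc]
      calc v (t + 1) ≤ (1 - a t) * v t := h t ht
        _ ≤ Real.exp (-a t) * v t :=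
          mul_le_mul_of_nonneg_right (Real.one_sub_le_exp_neg _) (hv t)
        _ ≤ _ := mul_le_mul_of_nonneg_left ih (Real.exp_pos _).le
  have hlim : Tendsto (fun t => Real.exp (A T - A t) * v T) atTop (𝓝 (0 * v T)) := by
    refine Tendsto.mul_const _ (Real.tendsto_exp_atBot.comp ?_)
    exact tendsto_const_nhds.add_atBot (tendsto_neg_atTop_atBot.comp ha)
  rw [zero_mul] at hlim
  refine tendsto_of_tendsto_of_tendsto_of_le_of_le' tendsto_const_nhds hlim
    (Eventually.of_forall hv) ?_
  filter_upwards [eventually_ge_atTop T] with t ht using key t ht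

/-- Subtracting the remainder `r` of the convergent noise series leaves a recursion in which the
noise enters only as `a t * r t`, with `r` tending to `0`. -/
theorem tendsto_of_stochasticApproximation {y a d : ℕ → ℝ} {m L : ℝ} (ha : ∀ t, 0 ≤ a t)
    (ha0 : Tendsto a atTop (𝓝 0)) (hsum : ¬ Summable a)
    (hd : Tendsto (fun n => ∑ s ∈ Finset.range n, d s) atTop (𝓝 L))
    (hy : ∀ᶠ t in atTop, y (t + 1) = y t + a t * (m - y t) + d t) :
    Tendsto y atTop (𝓝 m) := by
  have hA := (not_summable_iff_tendsto_nat_atTop_of_nonneg ha).1 hsum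
  set r : ℕ → ℝ := fun n => ∑ s ∈ Finset.range n, d s - L with hr
  have hr0 : Tendsto r atTop (𝓝 0) := by simpa [hr] using hd.sub_const L
  set w : ℕ → ℝ := fun t => y t - m - r t with hw
  have hrec : ∀ᶠ t in atTop, w (t + 1) = (1 - a t) * w t - a t * r t := by
    filter_upwards [hy] with t ht
    simp only [hw, hr, ht, Finset.sum_range_succ]; ring
  have hw0 : Tendsto w atTop (𝓝 0) := by
    rw [Metric.tendsto_atTop']
    intro ε hε
    have hr' : ∀ᶠ t in atTop, |r t| ≤ ε / 2 := by
      filter_upwards [hr0.abs.eventually_le_const (u := ε / 2) (by simpa using half_pos hε)] with t ht using ht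
    have ha1 : ∀ᶠ t in atTop, a t ≤ 1 := ha0.eventually_le_const one_pos
    obtain ⟨T, hT⟩ := eventually_atTop.1 (hrec.and (hr'.and ha1))
    -- While `|r t| ≤ ε / 2`, only the excess of `|w|` over `ε / 2` is certain to contract.
    have hv := tendsto_zero_of_le_one_sub_mul (v := fun t => max (|w t| - ε / 2) 0)
      (fun t => le_max_right _ _) hA (T := T) (fun t ht => by
        obtain ⟨h1, h2, h3⟩ := hT t ht
        have h4 : |w (t + 1)| ≤ (1 - a t) * |w t| + a t * (ε / 2) := by
          rw [h1]
          calc _ ≤ |(1 - a t) * w t| + |a t * r t| := abs_sub _ _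
            _ = (1 - a t) * |w t| + a t * |r t| := by
              rw [abs_mul, abs_mul, abs_of_nonneg (ha t), abs_of_nonneg (sub_nonneg.2 h3)]
            _ ≤ _ := by gcongr; exact ha t
        have h5 : (1 - a t) * (|w t| - ε / 2) ≤ (1 - a t) * max (|w t| - ε / 2) 0 :=
          mul_le_mul_of_nonneg_left (le_max_left _ _) (sub_nonneg.2 h3)
        refine max_le (by linarith)
          (mul_nonneg (sub_nonneg.2 h3) (le_max_right _ _)))
    obtain ⟨N, hN⟩ := eventually_atTop.1 (hv.eventually_lt_const (half_pos hε))
    refine ⟨N, fun n hn => ?_⟩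
    have := (le_max_left (|w n| - ε / 2) 0).trans_lt (hN n hn.le)
    rw [Real.dist_eq, sub_zero]; linarith
  have := (hw0.add hr0).add_const m
  simpa [hw] using this

/-! ### Sums of bounded martingale differences -/

/-- Orthogonality of the increments bounds the second moments of the partial sums by `B`; then `|M|
≤ 1 + M ^ 2` gives an `L¹` bound, and martingale convergence applies. -/
theorem ae_exists_tendsto_sum_martingaleDifference {Ω : Type*} {mΩ : MeasurableSpace Ω}
    {Pr : Measure Ω} [IsProbabilityMeasure Pr] {ℱ : Filtration ℕ mΩ} {d : ℕ → Ω → ℝ} {B : ℝ}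
    (hmeas : ∀ n, StronglyMeasurable[ℱ (n + 1)] (d n))
    (hcond : ∀ n, Pr[d n | ℱ n] =ᵐ[Pr] 0)
    (hsq : ∀ n ω, ∑ s ∈ Finset.range n, d s ω ^ 2 ≤ B) :
    ∀ᵐ ω ∂Pr, ∃ L, Tendsto (fun n => ∑ s ∈ Finset.range n, d s ω) atTop (𝓝 L) := by
  have hB : ∀ n ω, d n ω ^ 2 ≤ B := fun n ω =>
    (Finset.single_le_sum (f := fun s => d s ω ^ 2) (fun s _ => sq_nonneg _)
      (Finset.self_mem_range_succ n)).trans (hsq (n + 1) ω)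
  have hbd : ∀ n ω, ‖d n ω‖ ≤ Real.sqrt B := fun n ω => Real.abs_le_sqrt (hB n ω)
  have hdm : ∀ n, StronglyMeasurable (d n) := fun n => (hmeas n).mono (ℱ.le _)
  have hint : ∀ n, Integrable (d n) Pr := fun n =>
    Integrable.of_bound (hdm n).aestronglyMeasurable _ (Eventually.of_forall (hbd n))
  set M : ℕ → Ω → ℝ := fun n => ∑ s ∈ Finset.range n, d s with hM
  have hMs : ∀ n, M (n + 1) = M n + d n := fun n => Finset.sum_range_succ _ _
  have hMad : ∀ n, StronglyMeasurable[ℱ n] (M n) := fun n =>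
    Finset.stronglyMeasurable_sum _ fun s hs =>
      (hmeas s).mono (ℱ.mono (Finset.mem_range.1 hs))
  have hMm : ∀ n, StronglyMeasurable (M n) := fun n => (hMad n).mono (ℱ.le _)
  have hMb : ∀ n ω, ‖M n ω‖ ≤ n * Real.sqrt B := fun n ω => by
    simp only [hM, Finset.sum_apply]
    refine (norm_sum_le_of_le _ fun s _ => hbd s ω).trans (by simp)
  have hMint : ∀ n, Integrable (M n) Pr := fun n =>
    Integrable.of_bound (hMm n).aestronglyMeasurable _ (Eventually.of_forall (hMb n))
  have hMart : Martingale M ℱ Pr := by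
    refine martingale_nat hMad hMint fun n => ?_
    rw [hMs]
    filter_upwards [condExp_add (hMint n) (hint n) (ℱ n), hcond n] with ω h1 h2
    rw [h1, Pi.add_apply, h2,
      condExp_of_stronglyMeasurable (ℱ.le n) (hMad n) (hMint n)]
    simp
  have hMd : ∀ n, Integrable (M n * d n) Pr := fun n =>
    (hint n).bdd_mul (hMm n).aestronglyMeasurable (Eventually.of_forall (hMb n))
  have hcross : ∀ n, ∫ ω, M n ω * d n ω ∂Pr = 0 := fun n => by
    have h1 := condExp_mul_of_stronglyMeasurable_left (hMad n) (hMd n) (hint n)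
    have h2 : Pr[M n * d n | ℱ n] =ᵐ[Pr] 0 := by
      filter_upwards [h1, hcond n] with ω h1 h2
      rw [h1, Pi.mul_apply, h2]; simp
    rw [show (fun ω => M n ω * d n ω) = M n * d n from rfl, ← integral_condExp (ℱ.le n),
      integral_congr_ae h2]
    simp
  have hdd : ∀ n, Integrable (fun ω => d n ω ^ 2) Pr := fun n =>
    Integrable.of_bound ((hdm n).pow 2).aestronglyMeasurable B
      (Eventually.of_forall fun ω => by simpa using hB n ω)
  have hMM : ∀ n, Integrable (fun ω => M n ω ^ 2) Pr := fun n =>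
    Integrable.of_bound ((hMm n).pow 2).aestronglyMeasurable ((n * Real.sqrt B) ^ 2)
      (Eventually.of_forall fun ω => by
        rw [norm_pow]; exact pow_le_pow_left₀ (norm_nonneg _) (hMb n ω) 2)
  have hL2 : ∀ n, ∫ ω, M n ω ^ 2 ∂Pr = ∫ ω, ∑ s ∈ Finset.range n, d s ω ^ 2 ∂Pr := by
    intro n
    induction n with
    | zero => simp [hM]
    | succ n ih =>
      simp_rw [Finset.sum_range_succ]
      rw [integral_add (integrable_finsetSum _ fun s _ => hdd s) (hdd n), ← ih]
      have : ∀ ω, M (n + 1) ω ^ 2 = M n ω ^ 2 + (2 * (M n ω * d n ω) + d n ω ^ 2) := fun ω => by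
        rw [hMs, Pi.add_apply]; ring
      simp_rw [this]
      have hi : Integrable (fun ω => 2 * (M n ω * d n ω)) Pr := (hMd n).const_mul 2
      rw [integral_add (hMM n) (by exact hi.add (hdd n)), integral_add hi (hdd n), integral_const_mul,
        hcross]
      simp
  have hL2' : ∀ n, ∫ ω, M n ω ^ 2 ∂Pr ≤ B := fun n => by
    rw [hL2]
    calc _ ≤ ∫ _, B ∂Pr :=
          integral_mono (integrable_finsetSum _ fun s _ => hdd s) (integrable_const _) (hsq n)
      _ = B := by simp
  have hL1 : ∀ n, eLpNorm (M n) 1 Pr ≤ ((1 + B).toNNReal : ENNReal) := fun n => by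
    rw [eLpNorm_one_eq_lintegral_enorm, ← ofReal_integral_norm_eq_lintegral_enorm (hMint n)]
    refine ENNReal.ofReal_le_ofReal ?_
    calc _ ≤ ∫ ω, (1 + M n ω ^ 2) ∂Pr :=
          integral_mono (hMint n).norm ((integrable_const _).add (hMM n)) fun ω => by
            have := sq_abs (M n ω)
            simp only [Real.norm_eq_abs]
            nlinarith [sq_nonneg (|M n ω| - 1)]
      _ ≤ 1 + B := by
          rw [integral_add (integrable_const _) (hMM n)]
          simpa using hL2' n
  filter_upwards [hMart.submartingale.exists_ae_tendsto_of_bdd hL1] with ω ⟨L, hLω⟩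
  exact ⟨L, by simpa [hM] using hLω⟩

/-! ### Saddle points of finite zero-sum games -/

theorem iInf_iSup_eq_of_saddlePoint {α β : Type*} [Finite α] [Finite β] {f : α → β → ℝ} {x : ℝ}
    (a : α) (b : β) (ha : ∀ v, f a v ≤ x) (hb : ∀ u, x ≤ f u b) :
    (⨅ u, ⨆ v, f u v) = x ∧ (⨆ v, ⨅ u, f u v) = x := by
  have : Nonempty α := ⟨a⟩
  have : Nonempty β := ⟨b⟩
  refine ⟨le_antisymm ?_ ?_, le_antisymm ?_ ?_⟩
  · exact (ciInf_le (Set.finite_range _).bddBelow a).trans (ciSup_le ha)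
  · exact le_ciInf fun u => (hb u).trans (le_ciSup (f := f u) (Set.finite_range _).bddAbove b)
  · exact ciSup_le fun v =>
      (ciInf_le (f := fun u => f u v) (Set.finite_range _).bddBelow a).trans (ha v)
  · exact (le_ciInf hb).trans
      (le_ciSup (f := fun v => ⨅ u, f u v) (Set.finite_range _).bddAbove b)

namespace StochasticGame

variable {S : Type u}

/-! ### The depth of a state -/

/-- The number of states that can be reached from `i` by a path of positive length. -/
def depth (G : StochasticGame.{u, v} S) (i : S) : ℕ :=
  {j | Relation.TransGen G.Edge i j}.ncard

variable {G : StochasticGame.{u, v} S}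

/-- Descendants of `j` are descendants of `i`, and `j` itself is a descendant of `i` only, by
acyclicity. -/
theorem depth_lt_of_edge [Finite S] (h : G.IsShortestPath) {i j : S} (hij : G.Edge i j) :
    G.depth j < G.depth i := by
  refine Set.ncard_lt_ncard ((Set.ssubset_iff_of_subset ?_).2 ⟨j, ?_, ?_⟩) (Set.toFinite _)
  · exact fun k hk => Relation.TransGen.head hij hk
  · exact Relation.TransGen.single hij
  · exact h.acyclic j

theorem depth_le [Finite S] (G : StochasticGame.{u, v} S) (i : S) : G.depth i ≤ Nat.card S := by
  rw [← Set.ncard_univ]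
  exact Set.ncard_le_ncard (Set.subset_univ _) (Set.toFinite _)

theorem IsShortestPath.induction [Finite S] (h : G.IsShortestPath) {p : S → Prop}
    (zero : p G.zero) (step : ∀ i, i ≠ G.zero → (∀ j, G.Edge i j → p j) → p i) (i : S) : p i := by
  induction hd : G.depth i using Nat.strong_induction_on generalizing i with
  | _ n ih =>
    by_cases hi : i = G.zero
    · exact hi ▸ zero
    · exact step i hi fun j hj => ih _ (hd ▸ depth_lt_of_edge h hj) j rfl

/-- Iterate `F`, keeping the value at `zero` equal to `0`: the value at a state settles once those
of its successors have, so the number of iterations needed is bounded by the depth. -/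
theorem IsShortestPath.exists_fixedPoint [Finite S] (h : G.IsShortestPath)
    (F : (S → ℝ) → S → ℝ)
    (hF : ∀ i ≠ G.zero, ∀ J K : S → ℝ, J G.zero = K G.zero → (∀ j, G.Edge i j → J j = K j) →
      F J i = F K i) :
    ∃ J : S → ℝ, J G.zero = 0 ∧ ∀ i ≠ G.zero, J i = F J i := by
  classical
  obtain ⟨U, hU_zero, hU⟩ : ∃ U : ℕ → S → ℝ, (∀ i, U 0 i = 0) ∧
      ∀ n i, U (n + 1) i = if i = G.zero then 0 else F (U n) i :=
    ⟨fun n => (fun J i => if i = G.zero then 0 else F J i)^[n] 0, fun i => rfl, fun n i => by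
      simp only [Function.iterate_succ_apply']⟩
  have hU0 : ∀ n, U n G.zero = 0 := fun n => by
    cases n with
    | zero => exact hU_zero _
    | succ n => rw [hU, if_pos rfl]
  -- The inequality is strict because even at depth `0` one application of `F` is needed to replace
  -- the arbitrary starting value.
  have key : ∀ i, ∀ n > G.depth i, U (n + 1) i = U n i := by
    refine h.induction (fun n _ => by rw [hU0, hU0]) fun i hi ih n hn => ?_
    obtain ⟨n, rfl⟩ := Nat.exists_eq_succ_of_ne_zero (Nat.ne_zero_of_lt hn)
    rw [hU, Nat.succ_eq_add_one, hU, if_neg hi, if_neg hi]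
    refine hF i hi _ _ (by rw [hU0, hU0]) fun j hj => ih j hj n ?_
    exact (depth_lt_of_edge h hj).trans_le (Nat.lt_succ_iff.1 hn)
  refine ⟨U (Nat.card S + 1), hU0 _, fun i hi => ?_⟩
  rw [← key i _ (Nat.lt_succ_of_le (G.depth_le i)), hU, if_neg hi]

/-! ### One-step lookahead and policy evaluation -/

theorem IsShortestPath.P_zero (h : G.IsShortestPath) (a b) {j : S} (hj : j ≠ G.zero) :
    G.P G.zero a b j = 0 := by
  have := (PMF.apply_eq_one_iff _ _).1 (h.absorbing a b)
  rw [PMF.apply_eq_zero_iff, this]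
  exact hj

theorem edge_of_P_ne_zero {i j : S} (hi : i ≠ G.zero) (hj : j ≠ G.zero) {a : G.A₁ i × G.A₂ i}
    (h : G.P i a.1 a.2 j ≠ 0) : G.Edge i j :=
  ⟨hi, hj, a, pos_iff_ne_zero.2 h⟩

variable [Fintype S]

/-- The expectation of `J` after one step from `i` under the combined action `a`. -/
def next (G : StochasticGame.{u, v} S) (J : S → ℝ) (i : S) (a : G.A₁ i × G.A₂ i) : ℝ :=
  ∑ j, (G.P i a.1 a.2 j).toReal * J j

/-- The cost of the combined action `a` in `i`, when `J` is the cost from the next state on. -/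
def lookahead (G : StochasticGame.{u, v} S) (J : S → ℝ) (i : S) (a : G.A₁ i × G.A₂ i) : ℝ :=
  G.c i a.1 a.2 + G.next J i a

theorem next_zero (h : G.IsShortestPath) (J : S → ℝ) (a : G.A₁ G.zero × G.A₂ G.zero) :
    G.next J G.zero a = J G.zero := by
  rw [next, Finset.sum_eq_single G.zero]
  · simp [h.absorbing]
  · intro j _ hj
    simp [h.P_zero _ _ hj]
  · simp

theorem next_congr {i : S} (hi : i ≠ G.zero) {J K : S → ℝ} (h0 : J G.zero = K G.zero)
    (h : ∀ j, G.Edge i j → J j = K j) (a : G.A₁ i × G.A₂ i) : G.next J i a = G.next K i a := by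
  refine Finset.sum_congr rfl fun j _ => ?_
  by_cases hP : G.P i a.1 a.2 j = 0
  · simp [hP]
  · by_cases hj : j = G.zero
    · rw [hj, h0]
    · rw [h j (edge_of_P_ne_zero hi hj hP)]

theorem next_mono_of_edge {i : S} (hi : i ≠ G.zero) {J K : S → ℝ} (h0 : J G.zero ≤ K G.zero)
    (h : ∀ j, G.Edge i j → J j ≤ K j) (a : G.A₁ i × G.A₂ i) : G.next J i a ≤ G.next K i a := by
  refine Finset.sum_le_sum fun j _ => ?_
  by_cases hP : G.P i a.1 a.2 j = 0
  · simp [hP]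
  · refine mul_le_mul_of_nonneg_left ?_ ENNReal.toReal_nonneg
    by_cases hj : j = G.zero
    · rw [hj]; exact h0
    · exact h j (edge_of_P_ne_zero hi hj hP)

theorem IsShortestPath.exists_policyValue (h : G.IsShortestPath) (π : G.JointPolicy) :
    ∃ J : S → ℝ, J G.zero = 0 ∧ ∀ i, J i = G.lookahead J i (π i) := by
  obtain ⟨J, h0, hJ⟩ := h.exists_fixedPoint (fun J i => G.lookahead J i (π i))
    fun i hi J K h0 hJK => by rw [lookahead, lookahead, next_congr hi h0 hJK]
  refine ⟨J, h0, fun i => ?_⟩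
  by_cases hi : i = G.zero
  · subst hi
    rw [lookahead, next_zero h, h.cost_zero, zero_add]
  · exact hJ i hi

/-- The cost function of the combined policy `π`, as the solution of its evaluation equation. -/
def IsShortestPath.policyValue (h : G.IsShortestPath) (π : G.JointPolicy) : S → ℝ :=
  (h.exists_policyValue π).choose

theorem IsShortestPath.policyValue_zero (h : G.IsShortestPath) (π : G.JointPolicy) :
    h.policyValue π G.zero = 0 :=
  (h.exists_policyValue π).choose_spec.1

theorem IsShortestPath.policyValue_eq (h : G.IsShortestPath) (π : G.JointPolicy) (i : S) :
    h.policyValue π i = G.lookahead (h.policyValue π) i (π i) :=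
  (h.exists_policyValue π).choose_spec.2 i

/-- Comparison principle, by backward induction and monotonicity of the expectation. It carries
one-step inequalities over to the total cost of a policy. -/
theorem IsShortestPath.policyValue_le (h : G.IsShortestPath) {π : G.JointPolicy} {J : S → ℝ}
    (h0 : J G.zero = 0) (hJ : ∀ i, G.lookahead J i (π i) ≤ J i) (i : S) :
    h.policyValue π i ≤ J i := by
  refine h.induction (p := fun i => h.policyValue π i ≤ J i) (by rw [h0, h.policyValue_zero]) (fun i hi ih => ?_) i
  rw [h.policyValue_eq]
  refine le_trans (add_le_add_right ?_ _) (hJ i)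
  exact next_mono_of_edge hi (by rw [h0, h.policyValue_zero]) ih _

theorem IsShortestPath.le_policyValue (h : G.IsShortestPath) {π : G.JointPolicy} {J : S → ℝ}
    (h0 : J G.zero = 0) (hJ : ∀ i, J i ≤ G.lookahead J i (π i)) (i : S) :
    J i ≤ h.policyValue π i := by
  refine h.induction (p := fun i => J i ≤ h.policyValue π i) (by rw [h0, h.policyValue_zero]) (fun i hi ih => ?_) i
  rw [h.policyValue_eq]
  refine le_trans (hJ i) (add_le_add_right ?_ _)
  exact next_mono_of_edge hi (by rw [h0, h.policyValue_zero]) ih _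

end StochasticGame

/-! ### The negamin operator, its fixed point and saddle points -/

namespace AlternatingGame

open StochasticGame

variable {S : Type u} {G : AlternatingGame.{u, v} S}

theorem zero_notMem_S₂ (G : AlternatingGame.{u, v} S) : G.zero ∉ G.S₂ := fun h => by
  have : G.zero ∈ G.S₁ ∪ G.S₂ := Or.inr h
  rw [G.cover] at this
  exact this rfl

theorem flip_of_mem {i : S} (hi : i ∈ G.S₂) (J : S → ℝ) : G.flip J i = -J i := if_pos hi

theorem flip_of_notMem {i : S} (hi : i ∉ G.S₂) (J : S → ℝ) : G.flip J i = J i := if_neg hi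

theorem flip_flip (G : AlternatingGame.{u, v} S) (J : S → ℝ) : G.flip (G.flip J) = J := by
  funext i
  by_cases hi : i ∈ G.S₂
  · simp [flip_of_mem hi]
  · simp [flip_of_notMem hi]

theorem flip_zero (G : AlternatingGame.{u, v} S) (J : S → ℝ) : G.flip J G.zero = J G.zero :=
  flip_of_notMem G.zero_notMem_S₂ J

theorem negCost_zero (h : G.IsShortestPath) (a : G.A₁ G.zero × G.A₂ G.zero) :
    G.negCost G.zero a = 0 := by
  rw [negCost, if_neg G.zero_notMem_S₂, h.cost_zero]

variable [Fintype S]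

theorem negQ_eq (J : S → ℝ) (i : S) (a : G.A₁ i × G.A₂ i) :
    G.negQ J i a = G.negCost i a - G.next J i a := rfl

-- This is where alternation enters. From `S₂` no successor lies in `S₂`, so the flip changes
-- nothing; from `S₁` every successor is in `S₂` or `zero`, and the flip cancels the minus sign of
-- `negQ`. At `zero` the sign is immaterial because `J` vanishes there.
open Classical in
theorem negQ_flip (h : G.IsShortestPath) {J : S → ℝ} (h0 : J G.zero = 0) (i : S)
    (a : G.A₁ i × G.A₂ i) :
    G.negQ (G.flip J) i a = if i ∈ G.S₂ then -G.lookahead J i a else G.lookahead J i a := by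
  by_cases hi : i ∈ G.S₂
  · rw [if_pos hi, negQ_eq, negCost, if_pos hi, lookahead, neg_add, sub_eq_add_neg]
    congr 2
    refine Finset.sum_congr rfl fun j _ => ?_
    by_cases hj : j ∈ G.S₂
    · simp [G.alternate i j a.1 a.2 (Or.inr ⟨hi, hj⟩)]
    · rw [flip_of_notMem hj]
  · rw [if_neg hi, negQ_eq, negCost, if_neg hi, lookahead, sub_eq_add_neg]
    congr 1
    rw [next, next, ← Finset.sum_neg_distrib]
    refine Finset.sum_congr rfl fun j _ => ?_
    by_cases hj : j ∈ G.S₂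
    · rw [flip_of_mem hj]; ring
    · rw [flip_of_notMem hj]
      by_cases hj0 : j = G.zero
      · simp [hj0, h0]
      · have hj1 : j ∈ G.S₁ := by
          have : j ∈ G.S₁ ∪ G.S₂ := by rw [G.cover]; exact hj0
          exact this.resolve_right hj
        by_cases hi0 : i = G.zero
        · subst hi0; simp [h.P_zero _ _ hj0]
        · have hi1 : i ∈ G.S₁ := by
            have : i ∈ G.S₁ ∪ G.S₂ := by rw [G.cover]; exact hi0
            exact this.resolve_right hi
          simp [G.alternate i j a.1 a.2 (Or.inl ⟨hi1, hj1⟩)]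

theorem negQ_zero (h : G.IsShortestPath) (J : S → ℝ) (a : G.A₁ G.zero × G.A₂ G.zero) :
    G.negQ J G.zero a = -J G.zero := by
  rw [negQ_eq, next_zero h, negCost_zero h, zero_sub]

theorem negaminOp_zero (h : G.IsShortestPath) (J : S → ℝ) :
    G.negaminOp J G.zero = -J G.zero := by
  simp only [negaminOp, negQ_zero h, ciInf_const]

theorem negaminOp_congr {i : S} (hi : i ≠ G.zero) {J K : S → ℝ} (h0 : J G.zero = K G.zero)
    (h : ∀ j, G.Edge i j → J j = K j) : G.negaminOp J i = G.negaminOp K i := by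
  simp only [negaminOp, negQ_eq, next_congr hi h0 h]

theorem negaminOp_le (J : S → ℝ) (i : S) (a : G.A₁ i × G.A₂ i) :
    G.negaminOp J i ≤ G.negQ J i a :=
  ciInf_le (Set.finite_range _).bddBelow a

theorem exists_isGreedy (G : AlternatingGame.{u, v} S) (J : S → ℝ) :
    ∃ π : G.JointPolicy, G.IsGreedy J π := by
  choose π hπ using fun i => Finite.exists_min (G.negQ J i)
  exact ⟨π, hπ⟩

theorem IsGreedy.negaminOp_eq {J : S → ℝ} {π : G.JointPolicy} (h : G.IsGreedy J π) (i : S) :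
    G.negaminOp J i = G.negQ J i (π i) :=
  le_antisymm (negaminOp_le J i _) (le_ciInf (h i))

theorem exists_negaminOp_eq_self (h : G.IsShortestPath) : ∃ J : S → ℝ, G.negaminOp J = J := by
  obtain ⟨J, h0, hJ⟩ := h.exists_fixedPoint G.negaminOp fun i hi J K => negaminOp_congr hi
  refine ⟨J, funext fun i => ?_⟩
  by_cases hi : i = G.zero
  · rw [hi, negaminOp_zero h, h0, neg_zero]
  · exact (hJ i hi).symm

/-- At `zero` the negamin equation reads `J = -J`. This fixes the boundary value, which the minimax
equation would leave free. -/
theorem eq_zero_of_negaminOp_eq_self (h : G.IsShortestPath) {J : S → ℝ}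
    (hJ : G.negaminOp J = J) : J G.zero = 0 := by
  have := congrFun hJ G.zero
  rw [negaminOp_zero h] at this
  linarith

theorem negaminOp_fixedPoint_unique (h : G.IsShortestPath) {J K : S → ℝ}
    (hJ : G.negaminOp J = J) (hK : G.negaminOp K = K) : J = K := by
  have h0 : J G.zero = K G.zero := by
    rw [eq_zero_of_negaminOp_eq_self h hJ, eq_zero_of_negaminOp_eq_self h hK]
  refine funext fun i => h.induction (p := fun i => J i = K i) h0 (fun i hi ih => ?_) i
  rw [← hJ, ← hK]
  exact negaminOp_congr hi h0 ih

/-- The negamin cost function of the combined policy `π`. -/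
def negPolicyValue (h : G.IsShortestPath) (π : G.JointPolicy) : S → ℝ :=
  G.flip (h.policyValue π)

theorem negPolicyValue_zero (h : G.IsShortestPath) (π : G.JointPolicy) :
    negPolicyValue h π G.zero = 0 := by
  rw [negPolicyValue, flip_zero, h.policyValue_zero]

theorem negPolicyValue_eq (h : G.IsShortestPath) (π : G.JointPolicy) (i : S) :
    negPolicyValue h π i = G.negQ (negPolicyValue h π) i (π i) := by
  rw [negPolicyValue, negQ_flip h (h.policyValue_zero π), flip, ← h.policyValue_eq]

/-- A greedy policy for the fixed point of the negamin operator consists of two policies that are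
optimal against all actions of the other player. -/
theorem lookahead_saddlePoint (h : G.IsShortestPath) {J : S → ℝ} (h0 : J G.zero = 0)
    (hJ : G.negaminOp (G.flip J) = G.flip J) {π : G.JointPolicy} (hπ : G.IsGreedy (G.flip J) π)
    (i : S) :
    (∀ v, G.lookahead J i ((π i).1, v) ≤ J i) ∧ ∀ u, J i ≤ G.lookahead J i (u, (π i).2) := by
  have hle : ∀ a, G.flip J i ≤ G.negQ (G.flip J) i a := fun a => by
    conv_lhs => rw [← hJ]
    exact negaminOp_le _ i a
  have heq : G.flip J i = G.negQ (G.flip J) i (π i) := by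
    conv_lhs => rw [← hJ]
    exact hπ.negaminOp_eq i
  simp only [negQ_flip h h0] at hle heq
  by_cases hi : i ∈ G.S₂
  · simp only [if_pos hi, flip_of_mem hi] at hle heq
    have := G.trivial₁ i hi
    refine ⟨fun v => ?_, fun u => ?_⟩
    · linarith [hle ((π i).1, v)]
    · rw [Subsingleton.elim u (π i).1]; linarith
  · simp only [if_neg hi, flip_of_notMem hi] at hle heq
    by_cases hi0 : i = G.zero
    · subst hi0
      simp [lookahead, next_zero h, h.cost_zero]
    · have hi1 : i ∈ G.S₁ := by
        have : i ∈ G.S₁ ∪ G.S₂ := by rw [G.cover]; exact hi0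
        exact this.resolve_right hi
      have := G.trivial₂ i hi1
      refine ⟨fun v => ?_, fun u => hle _⟩
      rw [Subsingleton.elim v (π i).2]; exact heq.ge

theorem minimaxOp_eq_self (h : G.IsShortestPath) {J : S → ℝ} (h0 : J G.zero = 0)
    (hJ : G.negaminOp (G.flip J) = G.flip J) : G.minimaxOp J = J := by
  obtain ⟨π, hπ⟩ := G.exists_isGreedy (G.flip J)
  funext i
  obtain ⟨h1, h2⟩ := lookahead_saddlePoint h h0 hJ hπ i
  exact (iInf_iSup_eq_of_saddlePoint (f := fun u v => G.lookahead J i (u, v)) _ _ h1 h2).1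

end AlternatingGame

namespace StochasticGame

variable {S : Type u} {G : StochasticGame.{u, v} S}

/-! ### Trajectories of the shortest path problem -/

/-- All transitions of the trajectory `x` have positive probability under `π`. -/
def IsAdmissible (G : StochasticGame.{u, v} S) (π : G.JointPolicy) (x : ℕ → S) : Prop :=
  ∀ n, G.P (x n) (π (x n)).1 (π (x n)).2 (x (n + 1)) ≠ 0

/-- Until absorption, every step lowers the depth by at least one, so depth plus elapsed time stays
at most `Nat.card S`. -/
theorem IsAdmissible.eq_zero [Finite S] (h : G.IsShortestPath) {π : G.JointPolicy} {x : ℕ → S}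
    (hx : G.IsAdmissible π x) {n : ℕ} (hn : Nat.card S + 1 ≤ n) : x n = G.zero := by
  have key : ∀ n, x n = G.zero ∨ G.depth (x n) + n ≤ Nat.card S := by
    intro n
    induction n with
    | zero => exact Or.inr (G.depth_le _)
    | succ n ih =>
      by_cases h1 : x (n + 1) = G.zero
      · exact Or.inl h1
      · by_cases h0 : x n = G.zero
        · refine absurd ?_ (hx n)
          revert h1
          generalize x (n + 1) = j
          intro h1
          rw [h0]
          exact h.P_zero _ _ h1
        · have := depth_lt_of_edge h (edge_of_P_ne_zero h0 h1 (hx n))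
          have := ih.resolve_left h0
          omega
  exact (key n).resolve_right (by omega)

/-- By the evaluation equation each cost is a decrement of the policy value plus a one-step
prediction error; the decrements telescope up to absorption. -/
theorem IsAdmissible.sum_cost [Fintype S] (h : G.IsShortestPath) {π : G.JointPolicy} {x : ℕ → S}
    (hx : G.IsAdmissible π x) :
    ∑' k, G.c (x k) (π (x k)).1 (π (x k)).2 = h.policyValue π (x 0) +
      ∑ n ∈ Finset.range (Nat.card S + 1),
        (h.policyValue π (x (n + 1)) - G.next (h.policyValue π) (x n) (π (x n))) := by
  have hc : ∀ n, G.c (x n) (π (x n)).1 (π (x n)).2 =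
      (h.policyValue π (x n) - h.policyValue π (x (n + 1))) +
        (h.policyValue π (x (n + 1)) - G.next (h.policyValue π) (x n) (π (x n))) := fun n => by
    have := h.policyValue_eq π (x n)
    rw [lookahead] at this
    linarith
  rw [tsum_eq_sum (s := Finset.range (Nat.card S + 1)) fun n hn => by
    rw [hx.eq_zero h (not_lt.1 fun hlt => hn (Finset.mem_range.2 hlt)), h.cost_zero]]
  rw [Finset.sum_congr rfl fun n _ => hc n, Finset.sum_add_distrib, Finset.sum_range_sub',
    hx.eq_zero h le_rfl, h.policyValue_zero, sub_zero]

/-! ### The law of the Markov chain -/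

section Chain

variable [Fintype S] [MeasurableSpace S] [DiscreteMeasurableSpace S] {p : PMF S}
  {π : G.JointPolicy}

instance : IsProbabilityMeasure (G.chainLaw p π) := by
  have : IsProbabilityMeasure p.toMeasure := PMF.toMeasure.isProbabilityMeasure p
  unfold chainLaw
  infer_instance

theorem chainLaw_map_hist (p : PMF S) (π : G.JointPolicy) (n : ℕ) :
    (G.chainLaw p π).map (fun x => (Preorder.frestrictLe (π := fun _ => S) n x, x (n + 1))) =
      (G.chainLaw p π).map (Preorder.frestrictLe (π := fun _ => S) n) ⊗ₘ G.histKernel π n := by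
  have : IsProbabilityMeasure p.toMeasure := PMF.toMeasure.isProbabilityMeasure p
  exact Kernel.map_frestrictLe_trajMeasure_compProd_eq_map_trajMeasure.symm

theorem ae_isAdmissible (p : PMF S) (π : G.JointPolicy) :
    ∀ᵐ x ∂(G.chainLaw p π), G.IsAdmissible π x := by
  refine ae_all_iff.2 fun n => ?_
  have hmap : ∀ᵐ y ∂(G.chainLaw p π).map
      (fun x => (Preorder.frestrictLe (π := fun _ => S) n x, x (n + 1))),
      G.P (y.1 ⟨n, Finset.mem_Iic.2 le_rfl⟩) (π (y.1 ⟨n, Finset.mem_Iic.2 le_rfl⟩)).1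
        (π (y.1 ⟨n, Finset.mem_Iic.2 le_rfl⟩)).2 y.2 ≠ 0 := by
    rw [chainLaw_map_hist, Measure.ae_compProd_iff (Set.toFinite _).measurableSet]
    refine Eventually.of_forall fun y => ?_
    change ∀ᵐ b ∂(G.P _ _ _).toMeasure, _
    rw [ae_iff, PMF.toMeasure_apply_eq_zero_iff _ (Set.toFinite _).measurableSet]
    refine Set.disjoint_left.2 fun b hb hb' => ?_
    simp only [ne_eq, not_not, Set.mem_ofPred_eq] at hb'
    exact (PMF.mem_support_iff _ _).1 hb hb'
  exact ae_of_ae_map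
    (f := fun x => (Preorder.frestrictLe (π := fun _ => S) n x, x (n + 1))) (by fun_prop) hmap

/-- The Markov property in martingale form. The history weight `f` leaves room for the signs that
start at the first visit of a state. -/
theorem integral_hist_mul_next_sub (p : PMF S) (π : G.JointPolicy) (n : ℕ)
    (f : (∀ _ : Finset.Iic n, S) → ℝ) (g : S → ℝ) :
    ∫ x, f (Preorder.frestrictLe (π := fun _ => S) n x) *
      (g (x (n + 1)) - G.next g (x n) (π (x n))) ∂(G.chainLaw p π) = 0 := by
  let F : (∀ _ : Finset.Iic n, S) × S → ℝ := fun y => f y.1 *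
    (g y.2 - G.next g (y.1 ⟨n, Finset.mem_Iic.2 le_rfl⟩) (π (y.1 ⟨n, Finset.mem_Iic.2 le_rfl⟩)))
  have h1 : ∫ y, F y ∂((G.chainLaw p π).map
      (fun x => (Preorder.frestrictLe (π := fun _ => S) n x, x (n + 1)))) = 0 := by
    rw [chainLaw_map_hist]
    have : IsProbabilityMeasure
        ((G.chainLaw p π).map (Preorder.frestrictLe (π := fun _ => S) n)) :=
      Measure.isProbabilityMeasure_map (by fun_prop)
    rw [Measure.integral_compProd Integrable.of_finite]
    refine integral_eq_zero_of_ae (Eventually.of_forall fun y => ?_)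
    set s := y ⟨n, Finset.mem_Iic.2 le_rfl⟩
    change ∫ b, f y * (g b - G.next g s (π s)) ∂(G.P s (π s).1 (π s).2).toMeasure = 0
    have := PMF.toMeasure.isProbabilityMeasure (G.P s (π s).1 (π s).2)
    rw [integral_const_mul, integral_sub Integrable.of_finite (integrable_const _),
      PMF.integral_eq_sum]
    simp [next]
  rw [integral_map (by fun_prop) (measurable_of_finite F).aestronglyMeasurable] at h1
  exact h1

theorem ae_chainLaw_pure (π : G.JointPolicy) (i : S) :
    ∀ᵐ x ∂(G.chainLaw (PMF.pure i) π), x 0 = i := by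
  have h1 : (G.chainLaw (PMF.pure i) π).map (Preorder.frestrictLe (π := fun _ => S) 0) =
      (PMF.pure i).toMeasure.map
        (MeasurableEquiv.piUnique (fun _ : Finset.Iic 0 => S)).symm := by
    rw [chainLaw, Kernel.trajMeasure, Measure.map_comp _ _ (by fun_prop),
      Kernel.traj_map_frestrictLe, Kernel.partialTraj_self, Measure.id_comp]
  have h2 : ∀ᵐ y ∂(G.chainLaw (PMF.pure i) π).map (Preorder.frestrictLe (π := fun _ => S) 0),
      y ⟨0, Finset.mem_Iic.2 le_rfl⟩ = i := by
    rw [h1, ae_map_iff (by fun_prop) (Set.toFinite _).measurableSet, PMF.toMeasure_pure,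
      ae_dirac_iff (Set.toFinite _).measurableSet]
    rfl
  exact ae_of_ae_map (by fun_prop) h2

theorem measurable_comp_coordinates (n : ℕ) (f : S → S → ℝ) :
    Measurable fun x : ℕ → S => f (x n) (x (n + 1)) := by
  have h : Measurable fun y : S × S => f y.1 y.2 := measurable_of_finite _
  have h' : Measurable fun x : ℕ → S => (x n, x (n + 1)) := by fun_prop
  exact h.comp h'

theorem integrable_comp_coordinates {μ : Measure (ℕ → S)} [IsFiniteMeasure μ] (n : ℕ)
    (f : S → S → ℝ) : Integrable (fun x => f (x n) (x (n + 1))) μ := by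
  have h : Integrable (fun y : S × S => f y.1 y.2) (μ.map fun x => (x n, x (n + 1))) :=
    Integrable.of_finite
  exact h.comp_measurable (by fun_prop)

theorem cost_eq_policyValue (h : G.IsShortestPath) (μ : ∀ i, G.A₁ i) (ν : ∀ i, G.A₂ i) (i : S) :
    G.cost μ ν i = h.policyValue (G.joint μ ν) i := by
  have h1 : ∀ᵐ x ∂(G.chainLaw (PMF.pure i) (G.joint μ ν)),
      ∑' k, G.c (x k) (μ (x k)) (ν (x k)) = h.policyValue (G.joint μ ν) i +
      ∑ n ∈ Finset.range (Nat.card S + 1), (h.policyValue (G.joint μ ν) (x (n + 1)) -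
        G.next (h.policyValue (G.joint μ ν)) (x n) (G.joint μ ν (x n))) := by
    filter_upwards [ae_isAdmissible (PMF.pure i) (G.joint μ ν), ae_chainLaw_pure _ i]
      with x hx hx0
    have := hx.sum_cost h
    rw [hx0] at this
    exact this
  have hint : ∀ n, Integrable (fun x : ℕ → S => h.policyValue (G.joint μ ν) (x (n + 1)) -
      G.next (h.policyValue (G.joint μ ν)) (x n) (G.joint μ ν (x n)))
      (G.chainLaw (PMF.pure i) (G.joint μ ν)) := fun n =>
    integrable_comp_coordinates n fun a b => h.policyValue (G.joint μ ν) b -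
      G.next (h.policyValue (G.joint μ ν)) a (G.joint μ ν a)
  rw [cost, integral_congr_ae h1,
    integral_add (integrable_const _) (integrable_finsetSum _ fun n _ => hint n),
    integral_finsetSum _ fun n _ => hint n, Finset.sum_eq_zero]
  · simp
  · intro n _
    simpa using integral_hist_mul_next_sub (PMF.pure i) (G.joint μ ν) n (fun _ => 1)
      (h.policyValue (G.joint μ ν))

end Chain

/-! ### Alternating signs from the first visit of a state -/

open Classical in
/-- `0` before the first visit of `i` by the trajectory `x`, and `1, -1, 1, …` from then on. -/
def visitSign (i : S) (x : ℕ → S) : ℕ → ℝ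
  | 0 => if x 0 = i then 1 else 0
  | n + 1 => if visitSign i x n = 0 then (if x (n + 1) = i then 1 else 0) else -visitSign i x n

theorem abs_visitSign_le (i : S) (x : ℕ → S) (n : ℕ) : |visitSign i x n| ≤ 1 := by
  induction n with
  | zero => rw [visitSign]; split_ifs <;> simp
  | succ n ih => rw [visitSign]; split_ifs <;> simp [ih]

theorem visitSign_congr {i : S} {x y : ℕ → S} {n : ℕ} (h : ∀ m ≤ n, x m = y m) :
    visitSign i x n = visitSign i y n := by
  induction n with
  | zero => rw [visitSign, visitSign, h 0 le_rfl]
  | succ n ih => rw [visitSign, visitSign, h _ le_rfl, ih fun m hm => h m (hm.trans n.le_succ)]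

theorem visitSign_eq_zero {i : S} {x : ℕ → S} {n : ℕ} (h : ∀ m ≤ n, x m ≠ i) :
    visitSign i x n = 0 := by
  induction n with
  | zero => rw [visitSign, if_neg (h 0 le_rfl)]
  | succ n ih =>
    rw [visitSign, if_pos (ih fun m hm => h m (hm.trans n.le_succ)), if_neg (h _ le_rfl)]

theorem visitSign_add {i : S} {x : ℕ → S} {N : ℕ} (hN : x N = i) (h : ∀ m < N, x m ≠ i) (k : ℕ) :
    visitSign i x (N + k) = (-1) ^ k := by
  induction k with
  | zero =>
    cases N with
    | zero => rw [add_zero, visitSign, if_pos hN, pow_zero]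
    | succ N =>
      rw [add_zero, visitSign, if_pos (visitSign_eq_zero fun m hm => h m (Nat.lt_succ_of_le hm)),
        if_pos hN, pow_zero]
  | succ k ih =>
    rw [← add_assoc, visitSign, ih, if_neg (by simp), pow_succ, mul_neg_one]

/-- The sign at time `n` is known from the history up to `n`, so it can serve as the weight in
`integral_hist_mul_next_sub`. -/
theorem exists_visitSign_eq_comp_frestrictLe (i : S) (n : ℕ) :
    ∃ f : (∀ _ : Finset.Iic n, S) → ℝ, ∀ x : ℕ → S,
      visitSign i x n = f (Preorder.frestrictLe (π := fun _ => S) n x) := by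
  refine ⟨fun y => visitSign i (fun m => y ⟨min m n, Finset.mem_Iic.2 (min_le_right m n)⟩) n,
    fun x => visitSign_congr fun m hm => ?_⟩
  simp [hm]

end StochasticGame

/-! ### The Monte Carlo estimate as policy cost plus centred noise -/

namespace AlternatingGame

open StochasticGame

variable {S : Type u} [Fintype S] {G : AlternatingGame.{u, v} S}

/-- The error of the Monte Carlo estimate for `i` along a trajectory that visits `i`, as a sum of
one-step prediction errors. -/
def noise (h : G.IsShortestPath) (π : G.JointPolicy) (i : S) (x : ℕ → S) : ℝ :=
  ∑ n ∈ Finset.range (Nat.card S + 1), visitSign i x n *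
    (G.next (negPolicyValue h π) (x n) (π (x n)) - negPolicyValue h π (x (n + 1)))

theorem noise_eq_zero (h : G.IsShortestPath) (π : G.JointPolicy) {i : S} {x : ℕ → S}
    (hx : ¬ ∃ k, x k = i) : noise h π i x = 0 :=
  Finset.sum_eq_zero fun n _ => by
    rw [visitSign_eq_zero fun m _ hm => hx ⟨m, hm⟩, zero_mul]

theorem exists_abs_noise_le (h : G.IsShortestPath) :
    ∃ C, 0 ≤ C ∧ ∀ π i x, |noise h π i x| ≤ C := by
  obtain ⟨C, hC⟩ := (Set.finite_range fun y : G.JointPolicy × S × S =>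
    |G.next (negPolicyValue h y.1) y.2.1 (y.1 y.2.1) - negPolicyValue h y.1 y.2.2|).bddAbove
  have hC' : ∀ π i j, |G.next (negPolicyValue h π) i (π i) - negPolicyValue h π j| ≤ C :=
    fun π i j => hC ⟨(π, i, j), rfl⟩
  refine ⟨(Nat.card S + 1 : ℕ) * max C 0, by positivity, fun π i x => ?_⟩
  refine (Finset.abs_sum_le_sum_abs _ _).trans ?_
  rw [← nsmul_eq_mul]
  refine (Finset.sum_le_card_nsmul _ _ (max C 0) fun n _ => ?_).trans_eq (by simp)
  rw [abs_mul]
  exact (mul_le_of_le_one_left (abs_nonneg _) (abs_visitSign_le _ _ _)).trans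
    ((hC' _ _ _).trans (le_max_left _ _))

/-- With `V` the negamin policy cost, each `c'` equals `V (x n) + V (x (n + 1))` plus a prediction
error. The sums telescope under alternating signs from the first visit on, leaving `V i`. -/
theorem estimate_eq (h : G.IsShortestPath) {π : G.JointPolicy} {i : S} {x : ℕ → S}
    (hx : G.IsAdmissible π x) (hi : ∃ k, x k = i) :
    G.estimate x π i = negPolicyValue h π i + noise h π i x := by
  set N := sInf {n | x n = i} with hN
  have hNi : x N = i := Nat.sInf_mem (s := {n | x n = i}) hi
  have hlt : ∀ m < N, x m ≠ i := fun m hm => Nat.notMem_of_lt_sInf hm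
  set V := negPolicyValue h π with hV
  set K := Nat.card S + 1 with hK
  set D : ℕ → ℝ := fun n => G.next V (x n) (π (x n)) - V (x (n + 1)) with hD
  have hc : ∀ n, G.negCost (x n) (π (x n)) = V (x n) + V (x (n + 1)) + D n := fun n => by
    have := negPolicyValue_eq h π (x n)
    rw [negQ_eq, ← hV] at this
    simp only [hD]
    linarith
  have hD0 : ∀ n ≥ K, D n = 0 := fun n hn => by
    simp only [hD]
    rw [hx.eq_zero h hn, hx.eq_zero h (hn.trans n.le_succ), next_zero h, sub_self]
  have htel : ∀ K, ∑ k ∈ Finset.range K, (-1 : ℝ) ^ k * (V (x (N + k)) + V (x (N + k + 1))) =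
      V (x N) - (-1) ^ K * V (x (N + K)) := fun K => by
    induction K with
    | zero => simp
    | succ K ih => rw [Finset.sum_range_succ, ih, pow_succ, ← add_assoc]; ring
  have hnoise : noise h π i x = ∑ k ∈ Finset.range K, (-1 : ℝ) ^ k * D (N + k) := by
    -- Errors vanish from time `K` on, so the range may be lengthened by `N`; exactly `K` terms then
    -- remain after the first visit.
    have h1 : noise h π i x = ∑ n ∈ Finset.range (N + K), visitSign i x n * D n := by
      refine Finset.sum_subset (Finset.range_mono (by omega)) fun n _ hn => ?_
      exact mul_eq_zero_of_right _
        (hD0 n (not_lt.1 fun hlt => hn (Finset.mem_range.2 hlt)))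
    rw [h1, Finset.sum_range_add, Finset.sum_eq_zero, zero_add]
    · simp_rw [visitSign_add hNi hlt]
    · intro n hn
      rw [visitSign_eq_zero fun m hm => hlt m (hm.trans_lt (Finset.mem_range.1 hn)), zero_mul]
  rw [hnoise, estimate, ← hN, tsum_eq_sum (s := Finset.range K) fun n hn => by
    have : K ≤ N + n := le_add_left (not_lt.1 fun hlt => hn (Finset.mem_range.2 hlt))
    rw [hx.eq_zero h this, negCost_zero h, mul_zero]]
  simp_rw [hc, mul_add _ (V _ + V _) _]
  rw [Finset.sum_add_distrib, htel, hNi, hx.eq_zero h (Nat.le_add_left _ _), hV,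
    negPolicyValue_zero, mul_zero, sub_zero]

variable [MeasurableSpace S] [DiscreteMeasurableSpace S]

theorem measurable_noise (h : G.IsShortestPath) (π : G.JointPolicy) (i : S) :
    Measurable (noise h π i) := by
  have key : ∀ n, Measurable fun x : ℕ → S => visitSign i x n *
      (G.next (negPolicyValue h π) (x n) (π (x n)) - negPolicyValue h π (x (n + 1))) := by
    intro n
    obtain ⟨f, hf⟩ := exists_visitSign_eq_comp_frestrictLe i n
    simp_rw [hf]
    refine ((measurable_of_finite f).comp (Preorder.measurable_frestrictLe n)).mul ?_
    exact measurable_comp_coordinates n fun a b => G.next (negPolicyValue h π) a (π a) -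
      negPolicyValue h π b
  exact Finset.measurable_fun_sum _ fun n _ => key n

theorem integral_noise (h : G.IsShortestPath) (p : PMF S) (π : G.JointPolicy) (i : S) :
    ∫ x, noise h π i x ∂(G.chainLaw p π) = 0 := by
  have hint : ∀ n, Integrable (fun x : ℕ → S => visitSign i x n *
      (G.next (negPolicyValue h π) (x n) (π (x n)) - negPolicyValue h π (x (n + 1))))
      (G.chainLaw p π) := fun n => by
    refine (integrable_comp_coordinates n fun a b => G.next (negPolicyValue h π) a (π a) -
      negPolicyValue h π b).bdd_mul (c := 1) ?_ (Eventually.of_forall fun x => abs_visitSign_le _ _ _)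
    obtain ⟨f, hf⟩ := exists_visitSign_eq_comp_frestrictLe i n
    simp_rw [hf]
    exact ((measurable_of_finite f).comp (by fun_prop)).aestronglyMeasurable
  simp only [noise]
  rw [integral_finsetSum _ fun n _ => hint n]
  refine Finset.sum_eq_zero fun n _ => ?_
  obtain ⟨f, hf⟩ := exists_visitSign_eq_comp_frestrictLe i n
  rw [← neg_zero, ← integral_hist_mul_next_sub p π n f (negPolicyValue h π), ← integral_neg]
  refine integral_congr_ae (Eventually.of_forall fun x => ?_)
  simp only [hf]; ring

/-- The two components of one greedy policy form a saddle point: against any opponent, the one-step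
inequalities integrate to cost bounds by the comparison lemmas. -/
theorem isValue_of_negaminOp_flip_eq (h : G.IsShortestPath) {J : S → ℝ} (h0 : J G.zero = 0)
    (hJ : G.negaminOp (G.flip J) = G.flip J) : G.IsValue J := by
  obtain ⟨π, hπ⟩ := G.exists_isGreedy (G.flip J)
  have hs := lookahead_saddlePoint h h0 hJ hπ
  intro i
  refine iInf_iSup_eq_of_saddlePoint (fun i => (π i).1) (fun i => (π i).2) (fun ν => ?_)
    fun μ => ?_
  · rw [cost_eq_policyValue h]
    exact h.policyValue_le h0 (fun i => (hs i).1 (ν i)) i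
  · rw [cost_eq_policyValue h]
    exact h.le_policyValue h0 (fun i => (hs i).2 (μ i)) i

end AlternatingGame

/-! ### Step sizes -/

open Classical in
/-- The step size `γ_t(i)` if the trajectory of iteration `t` visits `i`, and `0` otherwise. -/
def activeStep {S : Type u} (β : ℕ → ℝ) (rule : StepRule) (x : ℕ → ℕ → S) (i : S) (t : ℕ) : ℝ :=
  if ∃ k, x t k = i then stepSize β x t i rule else 0

open Classical in
/-- The number of iterations before `t` whose trajectory visits `i`. -/
def visitCount {S : Type u} (x : ℕ → ℕ → S) (i : S) (t : ℕ) : ℕ :=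
  ((Finset.range t).filter fun τ => ∃ k, x τ k = i).card

section StepSize

variable {S : Type u} {β : ℕ → ℝ} {rule : StepRule} {x : ℕ → ℕ → S} {i : S}

open Classical in
theorem visitCount_succ (x : ℕ → ℕ → S) (i : S) (t : ℕ) :
    visitCount x i (t + 1) = visitCount x i t + if ∃ k, x t k = i then 1 else 0 := by
  rw [visitCount, visitCount, Finset.card_filter, Finset.card_filter, Finset.sum_range_succ]

theorem visitCount_mono (x : ℕ → ℕ → S) (i : S) : Monotone (visitCount x i) :=
  monotone_nat_of_le_succ fun t => by rw [visitCount_succ]; exact Nat.le_add_right _ _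

-- A change of time: over successive visits the count takes each of the values `0, 1, 2, …` once.
open Classical in
theorem sum_visitCount (f : ℕ → ℝ) (x : ℕ → ℕ → S) (i : S) (n : ℕ) :
    ∑ t ∈ Finset.range n, (if ∃ k, x t k = i then f (visitCount x i t) else 0) =
      ∑ m ∈ Finset.range (visitCount x i n), f m := by
  induction n with
  | zero => simp [visitCount]
  | succ n ih =>
    rw [Finset.sum_range_succ, ih, visitCount_succ]
    split_ifs
    · rw [Finset.sum_range_succ]
    · simp

theorem stepSize_nonneg (hβ : ∀ t, 0 ≤ β t) (t : ℕ) : 0 ≤ stepSize β x t i rule := by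
  cases rule <;> exact hβ _

theorem activeStep_nonneg (hβ : ∀ t, 0 ≤ β t) (t : ℕ) : 0 ≤ activeStep β rule x i t := by
  rw [activeStep]
  split_ifs
  · exact stepSize_nonneg hβ t
  · exact le_rfl

/-- The bound is pathwise and does not depend on `x`, as the martingale argument requires. Under
`visits`, the sum is a partial sum of `β ^ 2` after the change of time. -/
theorem sum_sq_activeStep_le (hβ : Summable fun t => β t ^ 2) (n : ℕ) :
    ∑ t ∈ Finset.range n, activeStep β rule x i t ^ 2 ≤ ∑' t, β t ^ 2 := by
  classical
  cases rule with
  | time =>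
    refine le_trans (Finset.sum_le_sum fun t _ => ?_)
      (hβ.sum_le_tsum (Finset.range n) fun t _ => sq_nonneg _)
    rw [activeStep, stepSize]
    split_ifs
    · exact le_rfl
    · simpa using sq_nonneg (β t)
  | visits =>
    have h1 : ∀ t, activeStep β StepRule.visits x i t ^ 2 =
        if ∃ k, x t k = i then β (visitCount x i t) ^ 2 else 0 := fun t => by
      rw [activeStep]
      split_ifs
      · rfl
      · simp
    simp_rw [h1]
    rw [sum_visitCount fun m => β m ^ 2]
    exact hβ.sum_le_tsum _ fun t _ => sq_nonneg _

theorem tendsto_activeStep (hβ : Summable fun t => β t ^ 2) :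
    Tendsto (activeStep β rule x i) atTop (𝓝 0) := by
  have h := (summable_of_sum_range_le (fun t => sq_nonneg (activeStep β rule x i t))
    (sum_sq_activeStep_le hβ)).tendsto_atTop_zero
  have h' := h.sqrt
  rw [Real.sqrt_zero] at h'
  simp_rw [Real.sqrt_sq_eq_abs] at h'
  exact tendsto_zero_iff_abs_tendsto_zero _ |>.2 h'

theorem not_summable_activeStep_visits (hβ_nonneg : ∀ t, 0 ≤ β t) (hβ : ¬ Summable β)
    (h : Tendsto (visitCount x i) atTop atTop) :
    ¬ Summable (activeStep β StepRule.visits x i) := by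
  rw [not_summable_iff_tendsto_nat_atTop_of_nonneg (activeStep_nonneg hβ_nonneg)]
  have h1 := ((not_summable_iff_tendsto_nat_atTop_of_nonneg hβ_nonneg).1 hβ).comp h
  refine h1.congr fun n => ?_
  rw [Function.comp_apply, ← sum_visitCount]
  rfl

-- A bounded number of visits would leave a bounded sum, since every weight is at most `1`.
open Classical in
theorem tendsto_visitCount_of_not_summable
    (h : ¬ Summable fun t : ℕ => if ∃ k, x t k = i then (1 / ((t : ℝ) + 1)) else 0) :
    Tendsto (visitCount x i) atTop atTop := by
  refine tendsto_atTop_atTop_of_monotone (visitCount_mono x i) fun M => ?_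
  by_contra! hM
  refine h (summable_of_sum_range_le (c := M) (fun t => ?_) fun n => ?_)
  · split_ifs <;> positivity
  · calc _ ≤ ∑ t ∈ Finset.range n, (if ∃ k, x t k = i then (1 : ℝ) else 0) := by
          refine Finset.sum_le_sum fun t _ => ?_
          split_ifs
          · rw [div_le_one (by positivity)]
            linarith [(Nat.cast_nonneg t : (0 : ℝ) ≤ t)]
          · exact le_rfl
      _ = visitCount x i n := by rw [sum_visitCount fun _ => 1]; simp
      _ ≤ M := by exact_mod_cast (hM n).le

end StepSize

namespace AlternatingGame

open StochasticGame

variable {S : Type u} [Fintype S] {G : AlternatingGame.{u, v} S}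

/-! ### Convergence along a single run -/

/-- An action strictly worse than an optimal one for `J` is eventually strictly worse for `Jt`,
hence not greedy. Ties are harmless, and there are finitely many actions. -/
theorem eventually_negQ_eq_negaminOp {J : S → ℝ} {Jt : ℕ → S → ℝ} {π : ℕ → G.JointPolicy}
    (hgreedy : ∀ t, G.IsGreedy (Jt t) (π t)) {i : S} (hi : i ≠ G.zero)
    (h0 : Tendsto (fun t => Jt t G.zero) atTop (𝓝 (J G.zero)))
    (hlim : ∀ j, G.Edge i j → Tendsto (fun t => Jt t j) atTop (𝓝 (J j))) :
    ∀ᶠ t in atTop, G.negQ J i (π t i) = G.negaminOp J i := by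
  have hQ : ∀ a, Tendsto (fun t => G.negQ (Jt t) i a) atTop (𝓝 (G.negQ J i a)) := fun a => by
    refine tendsto_const_nhds.sub (tendsto_finsetSum _ fun j _ => ?_)
    by_cases hP : G.P i a.1 a.2 j = 0
    · simp [hP]
    · refine Tendsto.const_mul _ ?_
      by_cases hj : j = G.zero
      · rw [hj]; exact h0
      · exact hlim j (edge_of_P_ne_zero hi hj hP)
  obtain ⟨σ, hσ⟩ := G.exists_isGreedy J
  have hne : ∀ᶠ t in atTop, ∀ a, G.negQ J i (σ i) < G.negQ J i a → π t i ≠ a := by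
    refine eventually_all.2 fun a => ?_
    by_cases ha : G.negQ J i (σ i) < G.negQ J i a
    · filter_upwards [(hQ (σ i)).eventually_lt (hQ a) ha] with t ht _ hta
      exact absurd (hgreedy t i (σ i)) (not_le.2 (hta ▸ ht))
    · exact Eventually.of_forall fun t h => absurd h ha
  filter_upwards [hne] with t ht
  rw [hσ.negaminOp_eq]
  exact le_antisymm (not_lt.1 fun hlt => ht _ hlt rfl) (hσ i _)

theorem iterate_succ_eq (h : G.IsShortestPath) {β : ℕ → ℝ} {rule : StepRule} {J₀ : S → ℝ}
    {x : ℕ → ℕ → S} {π : ℕ → G.JointPolicy} (hx : ∀ t, G.IsAdmissible (π t) (x t)) (t : ℕ)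
    (i : S) :
    G.iterate β rule J₀ x π (t + 1) i = G.iterate β rule J₀ x π t i +
      activeStep β rule x i t * (negPolicyValue h (π t) i - G.iterate β rule J₀ x π t i) +
      activeStep β rule x i t * noise h (π t) i (x t) := by
  simp only [iterate, activeStep]
  split_ifs with hv
  · rw [estimate_eq h (hx t) hv]; ring
  · ring

theorem tendsto_iterate (h : G.IsShortestPath) {β : ℕ → ℝ} (hβ_nonneg : ∀ t, 0 ≤ β t)
    (hβ_sq : Summable fun t => β t ^ 2) {rule : StepRule} {J₀ J : S → ℝ}
    (hJ : G.negaminOp J = J) {x : ℕ → ℕ → S} {π : ℕ → G.JointPolicy}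
    (hgreedy : ∀ t, G.IsGreedy (G.iterate β rule J₀ x π t) (π t))
    (hx : ∀ t, G.IsAdmissible (π t) (x t))
    (hsum : ∀ i, ¬ Summable (activeStep β rule x i))
    (hnoise : ∀ i, ∃ L, Tendsto (fun n => ∑ t ∈ Finset.range n,
      activeStep β rule x i t * noise h (π t) i (x t)) atTop (𝓝 L)) (i : S) :
    Tendsto (fun t => G.iterate β rule J₀ x π t i) atTop (𝓝 (J i)) := by
  have hJ0 := eq_zero_of_negaminOp_eq_self h hJ
  have hlim : ∀ i, (∀ᶠ t in atTop, negPolicyValue h (π t) i = J i) →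
      Tendsto (fun t => G.iterate β rule J₀ x π t i) atTop (𝓝 (J i)) := fun i hi => by
    obtain ⟨L, hL⟩ := hnoise i
    refine tendsto_of_stochasticApproximation (activeStep_nonneg hβ_nonneg)
      (tendsto_activeStep hβ_sq) (hsum i) hL ?_
    filter_upwards [hi] with t ht
    rw [iterate_succ_eq h hx, ht]
  have h0 : ∀ᶠ t in atTop, negPolicyValue h (π t) G.zero = J G.zero :=
    Eventually.of_forall fun t => by rw [negPolicyValue_zero, hJ0]
  -- The induction runs on eventual equality of the targets, not on convergence of the iterates,
  -- which `hlim` derives from it.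
  refine hlim i (h.induction (p := fun i => ∀ᶠ t in atTop, negPolicyValue h (π t) i = J i) h0
    (fun i hi ih => ?_) i)
  have hsucc : ∀ᶠ t in atTop, ∀ j, G.Edge i j → negPolicyValue h (π t) j = J j := by
    refine eventually_all.2 fun j => ?_
    by_cases hj : G.Edge i j
    · filter_upwards [ih j hj] with t ht _ using ht
    · exact Eventually.of_forall fun t h => absurd h hj
  filter_upwards [hsucc, eventually_negQ_eq_negaminOp hgreedy hi (hlim _ h0)
    fun j hj => hlim j (ih j hj)] with t h1 h2
  rw [negPolicyValue_eq, negQ_eq, next_congr hi (by rw [negPolicyValue_zero, hJ0]) h1, ← negQ_eq,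
    h2, hJ]

/-! ### Almost sure properties of a run -/

section Run

variable [MeasurableSpace S] [DiscreteMeasurableSpace S] {p : PMF S} {β : ℕ → ℝ}
  {rule : StepRule} {J₀ : S → ℝ} {Ω : Type z} {mΩ : MeasurableSpace Ω} {Pr : Measure Ω}
  [IsProbabilityMeasure Pr] {ℱ : Filtration ℕ mΩ} {X : ℕ → Ω → ℕ → S}
  {pol : ℕ → Ω → G.JointPolicy}

omit [Fintype S] in
theorem measurableSet_visits (i : S) : MeasurableSet {x : ℕ → S | ∃ k, x k = i} := by
  have : {x : ℕ → S | ∃ k, x k = i} = ⋃ k, (fun x : ℕ → S => x k) ⁻¹' {i} := by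
    ext x; simp
  rw [this]
  exact MeasurableSet.iUnion fun k => measurable_pi_apply k (measurableSet_singleton i)

omit [IsProbabilityMeasure Pr] in
theorem IsRun.measurable_X' (run : G.IsRun p β rule J₀ Pr ℱ X pol) (t : ℕ) :
    Measurable (X t) :=
  (run.measurable_X t).mono (ℱ.le _) le_rfl

/-- Integrating the conditional law over a past event on which the policy is constant gives an
honest chain law. As there are finitely many policies, such events suffice for all later almost sure
statements. -/
theorem IsRun.map_restrict (run : G.IsRun p β rule J₀ Pr ℱ X pol) (t : ℕ) (π : G.JointPolicy)
    {A : Set Ω} (hA : MeasurableSet[ℱ t] A) (hAπ : ∀ ω ∈ A, pol t ω = π) :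
    (Pr.restrict A).map (X t) = Pr A • G.chainLaw p π := by
  have hA' : MeasurableSet A := ℱ.le t _ hA
  ext B hB
  have hXB : MeasurableSet (X t ⁻¹' B) := run.measurable_X' t hB
  have h1 : ∫ ω in A, (Pr⟦X t ⁻¹' B | ℱ t⟧) ω ∂Pr = Pr.real (X t ⁻¹' B ∩ A) := by
    rw [setIntegral_condExp (ℱ.le t) ((integrable_const _).indicator hXB) hA,
      integral_indicator_const _ hXB]
    simp [measureReal_restrict_apply hXB]
  have h2 : ∫ ω in A, (Pr⟦X t ⁻¹' B | ℱ t⟧) ω ∂Pr = Pr.real A * (G.chainLaw p π).real B := by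
    rw [setIntegral_congr_ae (g := fun _ => (G.chainLaw p π).real B) hA']
    · simp
    · filter_upwards [run.law t B hB] with ω hω hωA
      rw [hω, hAπ ω hωA]
  rw [Measure.map_apply (run.measurable_X' t) hB, Measure.restrict_apply hXB,
    Measure.smul_apply, smul_eq_mul,
    ← ENNReal.toReal_eq_toReal_iff' (measure_ne_top _ _)
      (ENNReal.mul_ne_top (measure_ne_top _ _) (measure_ne_top _ _)), ENNReal.toReal_mul]
  exact h1.symm.trans h2

theorem IsRun.ae_isAdmissible (run : G.IsRun p β rule J₀ Pr ℱ X pol) :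
    ∀ᵐ ω ∂Pr, ∀ t, G.IsAdmissible (pol t ω) (X t ω) := by
  refine ae_all_iff.2 fun t => ?_
  have h : ∀ᵐ ω ∂Pr, ∀ π, pol t ω = π → G.IsAdmissible π (X t ω) := by
    refine ae_all_iff.2 fun π => ?_
    have hm : MeasurableSet {ω | pol t ω = π} := ℱ.le t _ (run.measurable_pol t π)
    refine (ae_restrict_iff' hm).1 (ae_of_ae_map (run.measurable_X' t).aemeasurable ?_)
    rw [run.map_restrict t π (run.measurable_pol t π) fun ω hω => hω]
    exact Measure.ae_smul_measure (StochasticGame.ae_isAdmissible p π) _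
  filter_upwards [h] with ω hω using hω _ rfl

omit [IsProbabilityMeasure Pr] in
theorem IsRun.measurable_comp (run : G.IsRun p β rule J₀ Pr ℱ X pol) (t : ℕ)
    {g : G.JointPolicy → (ℕ → S) → ℝ} (hg : ∀ π, Measurable (g π)) :
    Measurable[ℱ (t + 1)] fun ω => g (pol t ω) (X t ω) := by
  classical
  have := Fintype.ofFinite G.JointPolicy
  have h1 : (fun ω => g (pol t ω) (X t ω)) = fun ω => ∑ π : G.JointPolicy,
      {ω | pol t ω = π}.indicator (fun ω => g π (X t ω)) ω := by
    funext ω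
    rw [Finset.sum_eq_single (pol t ω)] <;> simp +contextual [Set.indicator, eq_comm]
  rw [h1]
  refine Finset.measurable_fun_sum _ fun π _ => Measurable.indicator ?_ ?_
  · exact (hg π).comp (run.measurable_X t)
  · exact ℱ.mono t.le_succ _ (run.measurable_pol t π)

theorem IsRun.condExp_eq_zero (run : G.IsRun p β rule J₀ Pr ℱ X pol) (t : ℕ)
    {g : G.JointPolicy → (ℕ → S) → ℝ} (hg : ∀ π, Measurable (g π)) {C : ℝ}
    (hC : ∀ π x, |g π x| ≤ C) (hg0 : ∀ π, ∫ x, g π x ∂(G.chainLaw p π) = 0) :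
    Pr[fun ω => g (pol t ω) (X t ω) | ℱ t] =ᵐ[Pr] 0 := by
  classical
  have hm : Measurable fun ω => g (pol t ω) (X t ω) :=
    (run.measurable_comp t hg).mono (ℱ.le _) le_rfl
  have hint : Integrable (fun ω => g (pol t ω) (X t ω)) Pr :=
    Integrable.of_bound hm.aestronglyMeasurable C (Eventually.of_forall fun ω => hC _ _)
  refine (ae_eq_condExp_of_forall_setIntegral_eq (ℱ.le t) hint
    (fun s _ _ => (integrable_zero _ _ _).integrableOn) (fun A hA _ => ?_)
    aestronglyMeasurable_zero).symm
  have hpol : ∀ π, MeasurableSet {ω | pol t ω = π} := fun π =>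
    ℱ.le t _ (run.measurable_pol t π)
  have hA' : A = ⋃ π, A ∩ {ω | pol t ω = π} := by
    ext ω; simp
  have := Fintype.ofFinite G.JointPolicy
  rw [hA', integral_iUnion_fintype (fun π => (ℱ.le t _ hA).inter (hpol π))
    (fun π σ hπσ => Set.disjoint_left.2 fun ω h1 h2 => hπσ (h1.2.symm.trans h2.2))
    fun π => hint.integrableOn]
  simp only [Pi.zero_apply, integral_zero]
  refine (Finset.sum_eq_zero fun π _ => ?_).symm
  rw [setIntegral_congr_fun (g := fun ω => g π (X t ω)) ((ℱ.le t _ hA).inter (hpol π))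
    fun ω hω => by simp only; rw [hω.2],
    ← integral_map (run.measurable_X' t).aemeasurable (hg π).aestronglyMeasurable,
    run.map_restrict t π (hA.inter (run.measurable_pol t π)) fun ω hω => hω.2,
    integral_smul_measure, hg0, smul_zero]

theorem IsRun.ae_exists_tendsto_sum (run : G.IsRun p β rule J₀ Pr ℱ X pol)
    {w : ℕ → Ω → ℝ} (hw : ∀ t, Measurable[ℱ t] (w t)) {W : ℝ} (hW : ∀ t ω, |w t ω| ≤ W)
    {g : G.JointPolicy → (ℕ → S) → ℝ} (hg : ∀ π, Measurable (g π)) {C : ℝ}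
    (hC : ∀ π x, |g π x| ≤ C) (hg0 : ∀ π, ∫ x, g π x ∂(G.chainLaw p π) = 0) {B : ℝ}
    (hB : ∀ n ω, ∑ t ∈ Finset.range n, (w t ω * g (pol t ω) (X t ω)) ^ 2 ≤ B) :
    ∀ᵐ ω ∂Pr, ∃ L, Tendsto (fun n => ∑ t ∈ Finset.range n, w t ω * g (pol t ω) (X t ω))
      atTop (𝓝 L) := by
  refine ae_exists_tendsto_sum_martingaleDifference (ℱ := ℱ)
    (d := fun t ω => w t ω * g (pol t ω) (X t ω)) (fun t => ?_) (fun t => ?_) hB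
  · exact (((hw t).mono (ℱ.mono t.le_succ) le_rfl).mul
      (run.measurable_comp t hg)).stronglyMeasurable
  · have hm : Measurable fun ω => g (pol t ω) (X t ω) :=
      (run.measurable_comp t hg).mono (ℱ.le _) le_rfl
    have hint : Integrable (fun ω => g (pol t ω) (X t ω)) Pr :=
      Integrable.of_bound hm.aestronglyMeasurable C (Eventually.of_forall fun ω => hC _ _)
    have h1 := condExp_stronglyMeasurable_mul_of_bound (ℱ.le t) (hw t).stronglyMeasurable hint W
      (Eventually.of_forall (hW t))
    filter_upwards [h1, run.condExp_eq_zero t hg hC hg0] with ω h1 h2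
    refine h1.trans ?_
    rw [Pi.mul_apply, h2, Pi.zero_apply, mul_zero]

omit [IsProbabilityMeasure Pr] in
theorem IsRun.measurable_stepSize (run : G.IsRun p β rule J₀ Pr ℱ X pol) (t : ℕ) (i : S) :
    Measurable[ℱ t] fun ω => stepSize β (fun s => X s ω) t i rule := by
  classical
  cases rule with
  | time => exact measurable_const
  | visits =>
    have h1 : Measurable[ℱ t] fun ω => visitCount (fun s => X s ω) i t := by
      simp only [visitCount, Finset.card_filter]
      refine Finset.measurable_fun_sum _ fun τ hτ => ?_
      refine Measurable.ite ?_ measurable_const measurable_const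
      exact ℱ.mono (Finset.mem_range.1 hτ) _ (run.measurable_X τ (measurableSet_visits i))
    exact (measurable_of_countable β).comp h1

theorem IsRun.ae_exists_tendsto_sum_noise (run : G.IsRun p β rule J₀ Pr ℱ X pol)
    (h : G.IsShortestPath) (hβ : Summable fun t => β t ^ 2) (i : S) :
    ∀ᵐ ω ∂Pr, ∃ L, Tendsto (fun n => ∑ t ∈ Finset.range n,
      activeStep β rule (fun s => X s ω) i t * noise h (pol t ω) i (X t ω)) atTop (𝓝 L) := by
  obtain ⟨C, hC0, hC⟩ := exists_abs_noise_le h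
  -- `activeStep` depends on the current trajectory, whereas `stepSize` is `ℱ t`-measurable. The two
  -- agree against the noise, which vanishes when `i` is not visited.
  have heq : ∀ t ω, activeStep β rule (fun s => X s ω) i t * noise h (pol t ω) i (X t ω) =
      stepSize β (fun s => X s ω) t i rule * noise h (pol t ω) i (X t ω) := fun t ω => by
    rw [activeStep]
    split_ifs with hv
    · rfl
    · rw [noise_eq_zero h _ hv, mul_zero, mul_zero]
  have hβ_abs : ∀ m, |β m| ≤ Real.sqrt (∑' t, β t ^ 2) := fun m =>
    Real.abs_le_sqrt (hβ.le_tsum m fun _ _ => sq_nonneg _)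
  simp_rw [heq]
  refine run.ae_exists_tendsto_sum (g := fun π => noise h π i)
    (B := (∑' t, β t ^ 2) * C ^ 2) (fun t => run.measurable_stepSize t i)
    (W := Real.sqrt (∑' t, β t ^ 2)) (fun t ω => ?_) (fun π => measurable_noise h π i)
    (fun π x => hC π i x) (fun π => integral_noise h p π i) fun n ω => ?_
  · cases rule <;> exact hβ_abs _
  -- Back to `activeStep` for the bound: under `visits`, `stepSize` may stay constant over many
  -- iterations without visits, so its own squares need not have a bounded sum.
  · simp_rw [← heq, mul_pow]
    calc _ ≤ ∑ t ∈ Finset.range n, activeStep β rule (fun s => X s ω) i t ^ 2 * C ^ 2 :=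
          Finset.sum_le_sum fun t _ => mul_le_mul_of_nonneg_left
            (sq_le_sq' (abs_le.1 (hC _ _ _)).1 (abs_le.1 (hC _ _ _)).2) (sq_nonneg _)
      _ ≤ _ := by
          rw [← Finset.sum_mul]
          exact mul_le_mul_of_nonneg_right (sum_sq_activeStep_le hβ n) (sq_nonneg _)

-- The `b`-weighted series of visit indicators minus their conditional probabilities converges
-- almost surely. If the visited weights were summable, so would be the weights times visit
-- probabilities; but these probabilities are bounded below by a positive minimum over the finitely
-- many policies.
open Classical in
theorem IsRun.ae_not_summable_visits (run : G.IsRun p β rule J₀ Pr ℱ X pol)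
    (hreach : G.Reachable p) {b : ℕ → ℝ} (hb_nonneg : ∀ t, 0 ≤ b t) (hb : ¬ Summable b)
    (hb_sq : Summable fun t => b t ^ 2) (i : S) :
    ∀ᵐ ω ∂Pr, ¬ Summable fun t => if ∃ k, X t ω k = i then b t else 0 := by
  obtain ⟨π₀, hπ₀⟩ := Finite.exists_min fun π : G.JointPolicy => G.reachProb p π i
  set g : G.JointPolicy → (ℕ → S) → ℝ := fun π x =>
    {x : ℕ → S | ∃ k, x k = i}.indicator (fun _ => (1 : ℝ)) x - G.reachProb p π i with hg
  have hq : ∀ π : G.JointPolicy, G.reachProb p π i ≤ 1 := fun π => measureReal_le_one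
  have hgC : ∀ π x, |g π x| ≤ 1 := fun π x => by
    have h1 := hq π
    have h2 := hreach π i
    simp only [hg, Set.indicator]
    split_ifs <;> rw [abs_le] <;> constructor <;> linarith
  have hb_abs : ∀ m, |b m| ≤ Real.sqrt (∑' t, b t ^ 2) := fun m =>
    Real.abs_le_sqrt (hb_sq.le_tsum m fun _ _ => sq_nonneg _)
  have hconv := run.ae_exists_tendsto_sum (w := fun t _ => b t) (g := g) (C := 1)
    (fun t => measurable_const) (fun t _ => hb_abs t)
    (fun π => (measurable_const.indicator (measurableSet_visits i)).sub measurable_const) hgC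
    (fun π => by
      simp only [hg]
      rw [integral_sub ((integrable_const _).indicator (measurableSet_visits i))
        (integrable_const _), integral_indicator_const _ (measurableSet_visits i)]
      simp [reachProb])
    (B := ∑' t, b t ^ 2) (fun n ω => by
      refine le_trans (Finset.sum_le_sum fun t _ => ?_)
        (hb_sq.sum_le_tsum (Finset.range n) fun t _ => sq_nonneg _)
      rw [mul_pow]
      refine mul_le_of_le_one_right (sq_nonneg _) ?_
      rw [← sq_abs]
      exact pow_le_one₀ (abs_nonneg _) (hgC _ _))
  filter_upwards [hconv] with ω ⟨L, hL⟩ hsum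
  have h1 : Tendsto (fun n => ∑ t ∈ Finset.range n, b t * G.reachProb p (pol t ω) i) atTop
      (𝓝 ((∑' t, if ∃ k, X t ω k = i then b t else 0) - L)) := by
    refine (hsum.hasSum.tendsto_sum_nat.sub hL).congr fun n => ?_
    rw [← Finset.sum_sub_distrib]
    refine Finset.sum_congr rfl fun t _ => ?_
    simp only [hg, Set.indicator, Set.mem_ofPred_eq]
    split_ifs <;> ring
  have h2 := ((not_summable_iff_tendsto_nat_atTop_of_nonneg hb_nonneg).1 hb).atTop_mul_const
    (hreach π₀ i)
  refine not_tendsto_nhds_of_tendsto_atTop (tendsto_atTop_mono (fun n => ?_) h2) _ h1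
  rw [Finset.sum_mul]
  exact Finset.sum_le_sum fun t _ => mul_le_mul_of_nonneg_left (hπ₀ _) (hb_nonneg t)

theorem IsRun.ae_not_summable_activeStep (run : G.IsRun p β rule J₀ Pr ℱ X pol)
    (hreach : G.Reachable p) (hβ_nonneg : ∀ t, 0 ≤ β t) (hβ : ¬ Summable β)
    (hβ_sq : Summable fun t => β t ^ 2) (i : S) :
    ∀ᵐ ω ∂Pr, ¬ Summable (activeStep β rule (fun s => X s ω) i) := by
  cases rule with
  | time => exact run.ae_not_summable_visits hreach hβ_nonneg hβ hβ_sq i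
  | visits =>
    -- Any divergent, square-summable weights bounded by `1` would do here: they only serve to show
    -- that `i` is visited infinitely often.
    have h1 : ¬ Summable fun t : ℕ => 1 / ((t : ℝ) + 1) := fun h =>
      Real.not_summable_one_div_natCast ((summable_nat_add_iff 1).1 (by simpa using h))
    have h2 : Summable fun t : ℕ => (1 / ((t : ℝ) + 1)) ^ 2 := by
      have := (summable_nat_add_iff 1).2 (Real.summable_one_div_nat_pow.2 one_lt_two)
      simpa [div_pow] using this
    filter_upwards [run.ae_not_summable_visits hreach (fun t => by positivity) h1 h2 i] with ω hω
    exact not_summable_activeStep_visits hβ_nonneg hβ (tendsto_visitCount_of_not_summable hω)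

theorem IsRun.ae_tendsto_iterate (run : G.IsRun p β rule J₀ Pr ℱ X pol)
    (h : G.IsShortestPath) (hreach : G.Reachable p) (hβ_nonneg : ∀ t, 0 ≤ β t)
    (hβ : ¬ Summable β) (hβ_sq : Summable fun t => β t ^ 2) {J : S → ℝ}
    (hJ : G.negaminOp J = J) :
    ∀ᵐ ω ∂Pr, ∀ i, Tendsto
      (fun t => G.iterate β rule J₀ (fun s => X s ω) (fun s => pol s ω) t i)
      atTop (𝓝 (J i)) := by
  filter_upwards [run.ae_isAdmissible,
    ae_all_iff.2 (run.ae_not_summable_activeStep hreach hβ_nonneg hβ hβ_sq),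
    ae_all_iff.2 (run.ae_exists_tendsto_sum_noise h hβ_sq)] with ω h1 h2 h3
  exact tendsto_iterate h hβ_nonneg hβ_sq hJ (fun t => run.greedy t ω) h1 h2 h3

end Run

end AlternatingGame

end

/-! ### The main theorem -/

theorem mainTheorem3 {S : Type u} [Fintype S] [MeasurableSpace S] [DiscreteMeasurableSpace S]
    (G : AlternatingGame.{u, v} S) (p : PMF S)
    (hreach : G.Reachable p) (hcommon : G.CommonTransitions) (hssp : G.IsShortestPath)
    (β : ℕ → ℝ) (hβ_nonneg : ∀ t, 0 ≤ β t) (hβ_sum : ¬ Summable β)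
    (hβ_sq : Summable fun t => β t ^ 2) :
    ∃ Jstar : S → ℝ,
      G.IsValue Jstar ∧ G.minimaxOp Jstar = Jstar ∧
      (∀ J : S → ℝ, G.negaminOp J = J ↔ J = G.flip Jstar) ∧
      G.flip (G.flip Jstar) = Jstar ∧
      ∀ (rule : StepRule) (J₀ : S → ℝ) {Ω : Type z} {mΩ : MeasurableSpace Ω} (Pr : Measure Ω)
        [IsProbabilityMeasure Pr] (ℱ : Filtration ℕ mΩ) (X : ℕ → Ω → ℕ → S)
        (pol : ℕ → Ω → G.JointPolicy), G.IsRun p β rule J₀ Pr ℱ X pol →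
        (∀ᵐ ω ∂Pr, ∀ i, Tendsto
          (fun t => G.iterate β rule J₀ (fun s => X s ω) (fun s => pol s ω) t i)
          atTop (𝓝 (G.flip Jstar i))) ∧
        (∀ᵐ ω ∂Pr, ∀ i, Tendsto
          (fun t => G.flip (G.iterate β rule J₀ (fun s => X s ω) (fun s => pol s ω) t) i)
          atTop (𝓝 (Jstar i))) := by
  obtain ⟨J', hJ'⟩ := AlternatingGame.exists_negaminOp_eq_self hssp
  have hJ : G.negaminOp (G.flip (G.flip J')) = G.flip (G.flip J') := by
    rw [G.flip_flip]; exact hJ'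
  have h0 : G.flip J' G.zero = 0 := by
    rw [G.flip_zero]; exact AlternatingGame.eq_zero_of_negaminOp_eq_self hssp hJ'
  refine ⟨G.flip J', AlternatingGame.isValue_of_negaminOp_flip_eq hssp h0 hJ,
    AlternatingGame.minimaxOp_eq_self hssp h0 hJ, fun J => ⟨fun h => ?_, fun h => h ▸ hJ⟩,
    G.flip_flip _, fun rule J₀ Ω mΩ Pr _ ℱ X pol run => ?_⟩
  · exact AlternatingGame.negaminOp_fixedPoint_unique hssp h hJ
  · have hlim := run.ae_tendsto_iterate hssp hreach hβ_nonneg hβ_sum hβ_sq hJ'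
    rw [G.flip_flip]
    refine ⟨hlim, ?_⟩
    filter_upwards [hlim] with ω hω i
    by_cases hi : i ∈ G.S₂
    · simp only [AlternatingGame.flip_of_mem hi]
      exact (hω i).neg
    · simp only [AlternatingGame.flip_of_notMem hi]
      exact hω i
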